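/- For a finite separable field extension $K/k$ let $\widetilde K$ be its Galois closure, $G=\mathrm{Gal}(\widetilde K/k)$, $G'=\mathrm{Gal}(\widetilde K/K)$, and let $\lambda:G\to \mathrm{Sym}(G/G')$ be the action of $G$ by left multiplication on the left cosets of $G'$. The extension $K/k$ is called Hopf Galois if there is a finite-dimensional cocommutative $k$-Hopf algebra $H$ such that $K$ is an $H$-module algebra and the $k$-linear map $j:K\otimes_k H\to \mathrm{End}_k(K)$, $j(s\otimes h)(t)=s\,(ht)$, is bijective. It is called almost classically Galois if there is a regular subgroup $N$ of $\mathrm{Sym}(G/G')$ that is normalized by $\lambda(G)$ and contained in $\lambda(G)$. (1) Let $f\in\mathbb{Q}[X]$ be an irreducible polynomial of degree $4$ whose Galois group over $\mathbb{Q}$ is isomorphic to the symmetric group $S_4$, and let $d$ be its discriminant. Let $x$ be a root of $f$ and $\sqrt d$ a square root of $d$, both in some common extension field of $\mathbb{Q}$ (for instance a splitting field of $f$). Then $\mathbb{Q}(x,\sqrt d)/\mathbb{Q}$ is a Hopf Galois extension of degree $8$ that is not almost classically Galois. (2) The degree $8$ is the smallest possible for such an example: there is an extension of $\mathbb{Q}$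 of degree $8$ that is Hopf Galois but not almost classically Galois, whereas every Hopf Galois finite separable field extension $K/k$ (over any field $k$) of degree less than $8$ is almost classically Galois. -/

import Mathlib

open Polynomial TensorProduct IntermediateField

universe u v w

/-- A `k`-algebra homomorphism `μ : H → End_k(K)`, `h ↦ (t ↦ h t)`, makes `K` an `H`-module algebra:
`h (s t) = ∑ (h₍₁₎ s) (h₍₂₎ t)` and `h 1 = ε(h) 1`. -/
structure IsModuleAlgebraAction (k : Type u) (K : Type v) [Field k] [Field K] [Algebra k K]
    {H : Type v} [Ring H] [HopfAlgebra k H] (μ : H →ₐ[k] Module.End k K) : Prop where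
  map_mul : ∀ (h : H) (s t : K), μ h (s * t) =
    LinearMap.mul' k K
      (TensorProduct.map (μ.toLinearMap.flip s) (μ.toLinearMap.flip t)
        (Coalgebra.comul (R := k) h))
  map_one : ∀ h : H, μ h 1 = algebraMap k K (Coalgebra.counit (R := k) h)

/-- The `k`-linear map `j : K ⊗ H → End_k(K)`, `j (s ⊗ h) (t) = s (h t)`. -/
noncomputable def hopfGaloisMap (k : Type u) (K : Type v) [Field k] [Field K] [Algebra k K]
    {H : Type v} [Ring H] [HopfAlgebra k H] (μ : H →ₐ[k] Module.End k K) :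
    K ⊗[k] H →ₗ[k] Module.End k K :=
  LinearMap.mul' k (Module.End k K) ∘ₗ
    TensorProduct.map (Algebra.lmul k K).toLinearMap μ.toLinearMap

theorem hopfGaloisMap_tmul (k : Type u) (K : Type v) [Field k] [Field K] [Algebra k K]
    {H : Type v} [Ring H] [HopfAlgebra k H] (μ : H →ₐ[k] Module.End k K) (s : K) (h : H) (t : K) :
    hopfGaloisMap k K μ (s ⊗ₜ[k] h) t = s * μ h t := by
  simp [hopfGaloisMap]

/-- `K/k` is a Hopf Galois extension: there is a finite cocommutative `k`-Hopf algebra `H` such that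
`K` is an `H`-module algebra and `j : K ⊗ H → End_k(K)` is bijective.
(Letting `H` range over the universe of `K` is no restriction: `H` is a finite-dimensional
`k`-vector space and `k` embeds in `K`.) -/
def IsHopfGalois (k : Type u) (K : Type v) [Field k] [Field K] [Algebra k K] : Prop :=
  ∃ (H : Type v) (_ : Ring H) (_ : HopfAlgebra k H),
    Module.Finite k H ∧ Coalgebra.IsCocomm k H ∧
      ∃ μ : H →ₐ[k] Module.End k K,
        IsModuleAlgebraAction k K μ ∧ Function.Bijective (hopfGaloisMap k K μ)

/-- The Galois closure of a (separable, algebraic) extension `K/k`. -/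
abbrev GaloisClosure (k : Type u) (K : Type v) [Field k] [Field K] [Algebra k K] : Type v :=
  IntermediateField.normalClosure k K (AlgebraicClosure K)

/-- The subgroup `G' = Gal(K̃/K)` of `G = Gal(K̃/k)`, where `K̃` is the Galois closure of `K/k`. -/
noncomputable def galoisClosureStabilizer (k : Type u) (K : Type v) [Field k] [Field K] [Algebra k K] :
    Subgroup Gal(GaloisClosure k K/k) :=
  (IsScalarTower.toAlgHom k K (GaloisClosure k K)).fieldRange.fixingSubgroup

/-- The morphism `λ : G → Sym(G/G')` given by left multiplication on the left cosets. -/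
def cosetAction {G : Type v} [Group G] (G' : Subgroup G) : G →* Equiv.Perm (G ⧸ G') :=
  MulAction.toPermHom G (G ⧸ G')

/-- A subgroup of `Sym(X)` is regular if it acts simply transitively on `X`. -/
def IsRegularSubgroup {X : Type v} (N : Subgroup (Equiv.Perm X)) : Prop :=
  ∀ x y : X, ∃! σ : Equiv.Perm X, σ ∈ N ∧ σ x = y

/-- `K/k` is almost classically Galois: there is a regular subgroup `N` of `Sym(G/G')` that is
normalized by `λ(G)` and contained in `λ(G)`. -/
def IsAlmostClassicallyGalois (k : Type u) (K : Type v) [Field k] [Field K] [Algebra k K] : Prop :=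
  ∃ N : Subgroup (Equiv.Perm (Gal(GaloisClosure k K/k) ⧸ galoisClosureStabilizer k K)),
    IsRegularSubgroup N ∧
    (cosetAction (galoisClosureStabilizer k K)).range ≤ Subgroup.normalizer (N : Set _) ∧
    N ≤ (cosetAction (galoisClosureStabilizer k K)).range

/-! The proof rests on the Greither–Pareigis correspondence, which turns everything into a question
about permutation groups. The cosets `G/G'` are replaced by the embeddings of `K` in its Galois
closure `L`, with `G` acting by composition (`isAlmostClassicallyGalois_iff`). If `H` makes `K/k`
Hopf Galois, the group-like elements of `L ⊗ H` permute these embeddings regularly, and `G`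
normalizes the resulting group (`exists_isRegularSubgroup_of_isHopfGalois`). Conversely, a regular
group `N` normalized by `G` gives the Hopf algebra of `G`-invariants in `L[N]`, which acts on `K`
(`isHopfGalois_of_isRegularSubgroup`).

What remains is to decide when a transitive group `Γ` normalizing a regular group `N` also contains
a regular group that it normalizes. In degree below 8 this always holds
(`hasRegularNormal_of_card_lt_eight`): prime degree and degree 4 follow from orders and fixed
points, and degree 6 splits into `N` cyclic and `N ≅ S₃`.

For `ℚ(x, √d)` an embedding is a choice of root together with a sign of `√d`, so `Γ` is `S₄` acting
on `{1,2,3,4} × {±1}` with the signature on the second factor (`exists_equiv_embedding`). The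
product of the Klein four-group and `{±1}` is regular and normalized by `Γ`. No such group lies
inside `Γ` (`not_hasRegularNormal_signedPerm`): its element taking `(0, 1)` to `(0, -1)` would come
from a transposition of `{1,2,3}` and, by uniqueness, commute with a 3-cycle. The polynomial `X⁴ - X
- 1` has group `S₄`, so degree 8 does occur. -/

/-! ### Regular subgroups -/

section RegularSubgroups

open Equiv Subgroup

variable {X : Type u}

/-- Evaluation at a point identifies a regular subgroup with the underlying set. -/
noncomputable def IsRegularSubgroup.equiv {N : Subgroup (Perm X)} (hN : IsRegularSubgroup N)
    (x : X) : N ≃ X :=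
  Equiv.ofBijective (fun n => (n : Perm X) x)
    ⟨fun n m h => Subtype.ext ((hN x (n.1 x)).unique ⟨n.2, rfl⟩ ⟨m.2, h.symm⟩),
      fun y => let ⟨σ, hσ, _⟩ := hN x y; ⟨⟨σ, hσ.1⟩, hσ.2⟩⟩

theorem IsRegularSubgroup.card_eq {N : Subgroup (Perm X)} (hN : IsRegularSubgroup N) (x : X) :
    Nat.card N = Nat.card X := Nat.card_congr (hN.equiv x)

/-- Every point is `n x` with `n ∈ N`, and `g n x = n g x = n x`. Hence point stabilizers in the
normalizer act faithfully on `N` by conjugation. -/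
theorem IsRegularSubgroup.eq_one_of_commute {N : Subgroup (Perm X)} (hN : IsRegularSubgroup N)
    {x : X} {g : Perm X} (hx : g x = x) (hg : ∀ n ∈ N, g * n * g⁻¹ = n) : g = 1 := by
  ext y
  obtain ⟨n, ⟨hn, rfl⟩, -⟩ := hN x y
  have := congrArg (fun p : Perm X => p (g x)) (hg n hn)
  have hx' : g⁻¹ x = x := Perm.inv_eq_iff_eq.2 hx.symm
  simpa only [hx, hx', Perm.mul_apply, Perm.one_apply] using this

theorem mem_normalizer_of_le {N Γ : Subgroup (Perm X)} (h : Γ ≤ normalizer (N : Set _))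
    {g n : Perm X} (hg : g ∈ Γ) (hn : n ∈ N) : g * n * g⁻¹ ∈ N :=
  (mem_normalizer_iff.1 (h hg) n).1 hn

theorem isRegularSubgroup_of_stabilizer_eq_one {Γ : Subgroup (Perm X)} {x : X}
    (ht : ∀ y, ∃ g ∈ Γ, g x = y) (hs : ∀ g ∈ Γ, g x = x → g = 1) : IsRegularSubgroup Γ := by
  intro y z
  obtain ⟨g, hg, rfl⟩ := ht y
  obtain ⟨h, hh, rfl⟩ := ht z
  refine ⟨h * g⁻¹, ⟨Γ.mul_mem hh (Γ.inv_mem hg), by simp⟩, ?_⟩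
  rintro σ ⟨hσ, hx⟩
  have := hs (h⁻¹ * σ * g) (Γ.mul_mem (Γ.mul_mem (Γ.inv_mem hh) hσ) hg) (by simp [hx])
  rw [eq_mul_inv_iff_mul_eq, ← mul_right_inj h⁻¹, ← mul_assoc, this, inv_mul_cancel]

theorem card_dvd_card_of_transitive [Finite X] {Γ : Subgroup (Perm X)} {x : X}
    (ht : ∀ y, ∃ g ∈ Γ, g x = y) :
    Nat.card X * Nat.card (MulAction.stabilizer Γ x) = Nat.card Γ := by
  have h := (MulAction.stabilizer Γ x).card_eq_card_quotient_mul_card_subgroup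
  rw [← Nat.card_congr (MulAction.orbitEquivQuotientStabilizer Γ x)] at h
  have : MulAction.orbit Γ x = Set.univ := Set.eq_univ_of_forall fun y =>
    let ⟨g, hg, h⟩ := ht y; ⟨⟨g, hg⟩, h⟩
  rw [h, this, Nat.card_univ]

theorem isRegularSubgroup_of_card_eq [Finite X] {Γ : Subgroup (Perm X)} {x : X}
    (ht : ∀ y, ∃ g ∈ Γ, g x = y) (hc : Nat.card Γ = Nat.card X) : IsRegularSubgroup Γ := by
  have : Nonempty X := ⟨x⟩
  have h := card_dvd_card_of_transitive ht
  rw [hc, Nat.mul_eq_left Nat.card_pos.ne', Subgroup.card_eq_one] at h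
  refine isRegularSubgroup_of_stabilizer_eq_one ht fun g hg hx => ?_
  have : (⟨g, hg⟩ : Γ) ∈ MulAction.stabilizer Γ x := hx
  rw [h, Subgroup.mem_bot] at this
  exact congrArg Subtype.val this

/-- The regular subgroups `N` of `Sym(X)` that witness almost classical Galois structures. -/
def HasRegularNormal (Γ : Subgroup (Perm X)) : Prop :=
  ∃ N : Subgroup (Perm X), IsRegularSubgroup N ∧ Γ ≤ normalizer (N : Set _) ∧ N ≤ Γ

theorem hasRegularNormal_self {Γ : Subgroup (Perm X)} (h : IsRegularSubgroup Γ) :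
    HasRegularNormal Γ := ⟨Γ, h, le_normalizer, le_rfl⟩

/-- The order of the normalizer is `|X|` times the index of `N` in it, and it divides `|X|!`; cancel
`|X|`. -/
theorem relIndex_dvd_factorial [Finite X] {N Γ : Subgroup (Perm X)} (hN : IsRegularSubgroup N)
    (x : X) (h : Γ ≤ normalizer (N : Set _)) : N.relIndex Γ ∣ (Nat.card X - 1).factorial := by
  have : Nonempty X := ⟨x⟩
  have h1 : N.relIndex Γ ∣ N.relIndex (normalizer (N : Set (Perm X))) := by
    rw [← relIndex_subgroupOf h]
    exact relIndex_dvd_index_of_normal _ _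
  refine h1.trans ?_
  have h2 := (N.subgroupOf (normalizer (N : Set (Perm X)))).card_mul_index
  rw [Nat.card_congr (subgroupOfEquivOfLe le_normalizer).toEquiv, hN.card_eq x] at h2
  have h3 := card_subgroup_dvd_card (normalizer (N : Set (Perm X)))
  rw [← h2, Nat.card_perm, ← Nat.mul_factorial_pred Nat.card_pos.ne'] at h3
  exact Nat.dvd_of_mul_dvd_mul_left Nat.card_pos h3

theorem card_inf_mul_relIndex' [Finite X] (N Γ : Subgroup (Perm X)) :
    Nat.card (N ⊓ Γ : Subgroup (Perm X)) * N.relIndex Γ = Nat.card Γ := by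
  have := (N.subgroupOf Γ).card_mul_index
  rwa [← inf_subgroupOf_right, Nat.card_congr (subgroupOfEquivOfLe inf_le_right).toEquiv,
    inf_subgroupOf_right] at this

theorem le_of_card_inf_eq [Finite X] {N Γ : Subgroup (Perm X)}
    (h : Nat.card (N ⊓ Γ : Subgroup (Perm X)) = Nat.card N) : N ≤ Γ :=
  inf_eq_left.1 (eq_of_le_of_card_ge inf_le_left h.ge)

/-- The prime `p = |X|` divides `|Γ| = |N ∩ Γ| · [Γ : N ∩ Γ]`, but the index divides `(p - 1)!`. So
`p` divides `|N ∩ Γ|`, which forces `N ≤ Γ`. -/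
theorem hasRegularNormal_of_card_prime [Finite X] {N Γ : Subgroup (Perm X)}
    (hN : IsRegularSubgroup N) (h : Γ ≤ normalizer (N : Set _)) {x : X}
    (ht : ∀ y, ∃ g ∈ Γ, g x = y) (hp : (Nat.card X).Prime) : HasRegularNormal Γ := by
  have h1 : Nat.card X ∣ Nat.card Γ := ⟨_, (card_dvd_card_of_transitive ht).symm⟩
  rw [← card_inf_mul_relIndex' N, hp.dvd_mul] at h1
  refine ⟨N, hN, h, le_of_card_inf_eq ?_⟩
  rcases h1 with h1 | h1
  · exact Nat.dvd_antisymm (card_dvd_of_le inf_le_left) (by rwa [hN.card_eq x])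
  · have := h1.trans (relIndex_dvd_factorial hN x h)
    rw [hp.dvd_factorial] at this
    have := hp.pos
    omega

/-- Unless `N ≤ Γ` or `Γ` is itself regular, divisibility leaves only `|N ∩ Γ| = 2` and `|Γ| = 12`.
An element `t` of order 3 then has a fixed point and centralizes the involution of `N ∩ Γ`, which
moves that point to a second fixed point. The number of fixed points is 1 modulo 3, so it is 4 and
`t = 1`. -/
theorem hasRegularNormal_of_card_four [Finite X] {N Γ : Subgroup (Perm X)}
    (hN : IsRegularSubgroup N) (h : Γ ≤ normalizer (N : Set _)) {x : X}
    (ht : ∀ y, ∃ g ∈ Γ, g x = y) (hX : Nat.card X = 4) : HasRegularNormal Γ := by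
  classical
  have := Fintype.ofFinite X
  have h1 : Nat.card X ∣ Nat.card Γ := ⟨_, (card_dvd_card_of_transitive ht).symm⟩
  have hr := relIndex_dvd_factorial hN x h
  have hi : Nat.card (N ⊓ Γ : Subgroup (Perm X)) ∣ Nat.card N := card_dvd_of_le inf_le_left
  have hΓ := card_inf_mul_relIndex' N Γ
  rw [hN.card_eq x, hX] at hi
  rw [hX] at h1 hr
  have hr : N.relIndex Γ ∣ 6 := hr
  by_cases h4 : Nat.card (N ⊓ Γ : Subgroup (Perm X)) = 4
  · exact ⟨N, hN, h, le_of_card_inf_eq (by rw [h4, hN.card_eq x, hX])⟩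
  by_cases h5 : Nat.card Γ = 4
  · exact hasRegularNormal_self (isRegularSubgroup_of_card_eq ht (h5.trans hX.symm))
  exfalso
  have hi' : Nat.card (N ⊓ Γ : Subgroup (Perm X)) = 2 ∧ N.relIndex Γ = 6 := by
    generalize Nat.card (N ⊓ Γ : Subgroup (Perm X)) = i at *
    generalize N.relIndex Γ = r at *
    have := Nat.le_of_dvd (by norm_num) hi
    have := Nat.le_of_dvd (by norm_num) hr
    rw [← hΓ] at h1 h5
    interval_cases i <;> interval_cases r <;> simp_all <;> omega
  have h3 : 3 ∣ Nat.card Γ := by rw [← hΓ, hi'.2]; exact ⟨_ * 2, by ring⟩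
  have : Fact (Nat.Prime 3) := ⟨Nat.prime_three⟩
  obtain ⟨t, ht3⟩ := exists_prime_orderOf_dvd_card' 3 h3
  have htp : (t : Perm X) ^ 3 ^ 1 = 1 := by
    rw [pow_one, ← ht3]; exact_mod_cast congrArg Subtype.val (pow_orderOf_eq_one t)
  have hmod := Perm.card_compl_support_modEq (σ := (t : Perm X)) (n := 1) (p := 3) htp
  rw [← Nat.card_eq_fintype_card, hX] at hmod
  obtain ⟨y, hy⟩ : ((t : Perm X).supportᶜ).Nonempty := by
    rw [← Finset.card_pos]
    rw [Nat.ModEq] at hmod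
    omega
  obtain ⟨v, hv, huniq⟩ := (Nat.card_eq_two_iff' (1 : (N ⊓ Γ : Subgroup (Perm X)))).1 hi'.1
  have hconj : (t : Perm X) * v * (t : Perm X)⁻¹ = v :=
    congrArg Subtype.val (huniq ⟨(t : Perm X) * v * (t : Perm X)⁻¹,
      mem_normalizer_of_le h t.2 v.2.1, Γ.mul_mem (Γ.mul_mem t.2 v.2.2) (Γ.inv_mem t.2)⟩
      fun hc => hv (Subtype.ext (by simpa using congrArg Subtype.val hc)))
  have hty : (t : Perm X) y = y := by simpa using hy
  have htv : (t : Perm X) (v.1 y) = v.1 y := by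
    have := congrArg (fun p : Perm X => p ((t : Perm X) y)) hconj
    have ht' : (t : Perm X)⁻¹ y = y := Perm.inv_eq_iff_eq.2 hty.symm
    simpa only [hty, ht', Perm.mul_apply] using this
  have hvy : v.1 y ≠ y := fun hc =>
    hv (Subtype.ext ((hN y y).unique ⟨v.2.1, hc⟩ ⟨N.one_mem, rfl⟩))
  have h2 : ({y, v.1 y} : Finset X) ⊆ (t : Perm X).supportᶜ := by
    intro z hz
    rcases Finset.mem_insert.1 hz with rfl | hz
    · simpa using hty
    · rw [Finset.mem_singleton.1 hz]; simpa using htv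
  have h2 := Finset.card_le_card h2
  rw [Finset.card_pair hvy.symm] at h2
  have h6 := Finset.card_compl_add_card (t : Perm X).support
  rw [← Nat.card_eq_fintype_card, hX] at h6
  have h7 : (t : Perm X).support.card = 0 := by rw [Nat.ModEq] at hmod; omega
  rw [Finset.card_eq_zero, Perm.support_eq_empty_iff] at h7
  have : t = 1 := Subtype.ext h7
  simp [this] at ht3

/-- Given `m ∈ N`, take `g ∈ Γ` with `g x = m x` and `t` in the stabilizer acting on `N` as `g`
does. As `N` is abelian, `m⁻¹ g t⁻¹` centralizes `N`; it fixes `x`, so it is trivial and `m = g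
t⁻¹`. -/
theorem le_of_conj_eq_conj_stabilizer {N Γ : Subgroup (Perm X)} (hN : IsRegularSubgroup N)
    (h : Γ ≤ normalizer (N : Set _)) (hc : ∀ a ∈ N, ∀ b ∈ N, a * b = b * a) {x : X}
    (ht : ∀ y, ∃ g ∈ Γ, g x = y)
    (hs : ∀ g ∈ Γ, ∃ t ∈ Γ, t x = x ∧ ∀ n ∈ N, g * n * g⁻¹ = t * n * t⁻¹) : N ≤ Γ := by
  intro m hm
  obtain ⟨g, hg, hgx⟩ := ht (m x)
  obtain ⟨t, ht, htx, htg⟩ := hs g hg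
  have ht' : t⁻¹ x = x := Perm.inv_eq_iff_eq.2 htx.symm
  have h1 : m⁻¹ * g * t⁻¹ = 1 := by
    refine hN.eq_one_of_commute (x := x) (by simp only [Perm.mul_apply, ht', hgx]; simp)
      fun n hn => ?_
    have h2 := htg (t⁻¹ * n * t) (by
      simpa using mem_normalizer_of_le h (Γ.inv_mem ht) hn)
    calc m⁻¹ * g * t⁻¹ * n * (m⁻¹ * g * t⁻¹)⁻¹ = m⁻¹ * (g * (t⁻¹ * n * t) * g⁻¹) * m := by group
      _ = m⁻¹ * (n * m) := by rw [h2]; group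
      _ = n := by rw [hc n hn m hm]; group
  have : m = g * t⁻¹ := by
    rw [mul_assoc, inv_mul_eq_one] at h1
    exact h1
  rw [this]
  exact Γ.mul_mem hg (Γ.inv_mem ht)

/-- Here `Aut N` has order 2. If the stabilizer in `Γ` is nontrivial, it acts faithfully on `N` and
so realizes both automorphisms, and `le_of_conj_eq_conj_stabilizer` applies; otherwise `Γ` is
regular. -/
theorem hasRegularNormal_of_isCyclic [Finite X] {N Γ : Subgroup (Perm X)}
    (hN : IsRegularSubgroup N) (h : Γ ≤ normalizer (N : Set _)) {x : X}
    (ht : ∀ y, ∃ g ∈ Γ, g x = y) [IsCyclic N] (hX : (Nat.card X).totient = 2) :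
    HasRegularNormal Γ := by
  by_cases hs : ∀ g ∈ Γ, g x = x → g = 1
  · exact hasRegularNormal_self (isRegularSubgroup_of_stabilizer_eq_one ht hs)
  push Not at hs
  obtain ⟨t, htΓ, htx, ht1⟩ := hs
  have hcard : Nat.card (MulAut N) = 2 := by rw [IsCyclic.card_mulAut, hN.card_eq x, hX]
  let c (g : Perm X) (hg : g ∈ Γ) : MulAut N := N.normalizerMonoidHom ⟨g, h hg⟩
  have hcoe (g hg n) : ((c g hg n : N) : Perm X) = g * n * g⁻¹ := rfl
  have hct : c t htΓ ≠ 1 := fun h1 => ht1 (hN.eq_one_of_commute htx fun n hn => by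
    rw [← hcoe t htΓ ⟨n, hn⟩, h1]; rfl)
  obtain ⟨d, hd, huniq⟩ := (Nat.card_eq_two_iff' (1 : MulAut N)).1 hcard
  refine ⟨N, hN, h, le_of_conj_eq_conj_stabilizer hN h (fun a ha b hb => ?_) ht fun g hg => ?_⟩
  · let := IsCyclic.commGroup (α := N)
    exact congrArg Subtype.val (mul_comm (⟨a, ha⟩ : N) ⟨b, hb⟩)
  · by_cases hg1 : c g hg = 1
    · refine ⟨1, Γ.one_mem, rfl, fun n hn => ?_⟩
      rw [← hcoe g hg ⟨n, hn⟩, hg1]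
      simp
    · refine ⟨t, htΓ, htx, fun n hn => ?_⟩
      rw [← hcoe g hg ⟨n, hn⟩, ← hcoe t htΓ ⟨n, hn⟩, huniq _ hg1, huniq _ hct]

/-- Take `c` of order 3 and `s` of order 2. If they commute, `c s` generates. If not, `⟨s⟩` is not
normal, so the action on its three cosets is faithful. -/
theorem isCyclic_or_mulEquiv_perm_of_card_six {N : Type u} [Group N] (hN : Nat.card N = 6) :
    IsCyclic N ∨ Nonempty (Perm (Fin 3) ≃* N) := by
  have : Finite N := Nat.finite_of_card_ne_zero (by omega)
  have : Fact (Nat.Prime 3) := ⟨Nat.prime_three⟩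
  obtain ⟨c, hc⟩ := exists_prime_orderOf_dvd_card' (G := N) 3 (by omega)
  obtain ⟨s, hs⟩ := exists_prime_orderOf_dvd_card' (G := N) 2 (by omega)
  by_cases hcs : Commute c s
  · left
    have := hcs.orderOf_mul_eq_mul_orderOf_of_coprime (by rw [hc, hs]; norm_num)
    exact isCyclic_of_orderOf_eq_card (c * s) (by rw [this, hc, hs, hN])
  right
  let φ := MulAction.toPermHom N (N ⧸ zpowers s)
  have hker : φ.ker = ⊥ := by
    have h1 : φ.ker ≤ zpowers s := by
      rw [← normalCore_eq_ker]; exact normalCore_le _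
    have h2 := card_dvd_of_le h1
    rw [Nat.card_zpowers, hs, Nat.dvd_prime Nat.prime_two] at h2
    rcases h2 with h2 | h2
    · exact Subgroup.card_eq_one.1 h2
    · exfalso
      have h3 : φ.ker = zpowers s :=
        eq_of_le_of_card_ge h1 (by rw [Nat.card_zpowers, hs, h2])
      have h4 : c * s * c⁻¹ ∈ φ.ker :=
        (inferInstance : φ.ker.Normal).conj_mem s (h3.symm ▸ mem_zpowers s : s ∈ φ.ker) c
      rw [h3, mem_zpowers_iff] at h4
      obtain ⟨k, hk⟩ := h4
      apply hcs
      obtain ⟨m, rfl | rfl⟩ := Int.even_or_odd' k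
      · rw [zpow_mul, zpow_ofNat, ← hs, pow_orderOf_eq_one, one_zpow, eq_comm, conj_eq_one_iff] at hk
        simp [hk] at hs
      · rw [zpow_add, zpow_mul, zpow_ofNat, ← hs, pow_orderOf_eq_one, one_zpow, one_mul, zpow_one,
          eq_mul_inv_iff_mul_eq] at hk
        exact hk.symm
  have hq : Nat.card (N ⧸ zpowers s) = 3 := by
    have := (zpowers s).card_eq_card_quotient_mul_card_subgroup
    rw [Nat.card_zpowers, hs, hN] at this
    omega
  have hbij : Function.Bijective φ := by
    rw [Nat.bijective_iff_injective_and_card]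
    exact ⟨(MonoidHom.ker_eq_bot_iff φ).1 hker, by rw [Nat.card_perm, hq, hN]; rfl⟩
  exact ⟨((Finite.equivFinOfCardEq hq).symm.permCongrHom).trans (MulEquiv.ofBijective φ hbij).symm⟩

/-! ### Subgroups of `S₃ × S₃` that act transitively on `S₃` by two-sided translations -/

section PermFinThree

theorem perm_three_generated_of_odd {u v : Perm (Fin 3)} (hu : Perm.sign u = -1)
    (hv : Perm.sign v = -1) (huv : u ≠ v) {D : Subgroup (Perm (Fin 3))} (hu' : u ∈ D)
    (hv' : v ∈ D) : D = ⊤ := by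
  have key : ∀ u v : Perm (Fin 3), Perm.sign u = -1 → Perm.sign v = -1 → u ≠ v → ∀ x,
      x = 1 ∨ x = u ∨ x = v ∨ x = u * v ∨ x = v * u ∨ x = u * v * u := by decide
  rw [eq_top_iff]
  rintro x -
  rcases key u v hu hv huv x with rfl | rfl | rfl | rfl | rfl | rfl
  exacts [D.one_mem, hu', hv', D.mul_mem hu' hv', D.mul_mem hv' hu',
    D.mul_mem (D.mul_mem hu' hv') hu']

/-- If some first component does not centralize the transposition `u`, conjugation yields a second
transposition and hence all of `S₃ × 1`. Otherwise the first components lie in `{1, u}`, and all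
depends on whether `D ∩ (1 × S₃)` contains a transposition: if so, transitivity makes it all of `1 ×
S₃`; if not, `(u, u) ∉ D`. -/
theorem perm_three_prod_of_odd_fst {D : Subgroup (Perm (Fin 3) × Perm (Fin 3))}
    (hD : ∀ x, ∃ p ∈ D, p.1 * p.2⁻¹ = x) {u : Perm (Fin 3)} (hu : Perm.sign u = -1)
    (huD : (u, 1) ∈ D) :
    (∀ a, (a, 1) ∈ D) ∨ (∀ b, (1, b) ∈ D) ∨ ∀ a, (a, a) ∈ D → a = 1 := by
  by_cases h1 : ∃ p ∈ D, p.1 * u * p.1⁻¹ ≠ u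
  · obtain ⟨p, hp, hpu⟩ := h1
    left
    let E := D.comap (MonoidHom.inl (Perm (Fin 3)) (Perm (Fin 3)))
    have hE : E = ⊤ := by
      refine perm_three_generated_of_odd hu
        (v := p.1 * u * p.1⁻¹) (by simp [hu]) hpu.symm huD ?_
      have := D.mul_mem (D.mul_mem hp huD) (D.inv_mem hp)
      simpa [E, Prod.mul_def] using this
    exact fun a => (hE ▸ mem_top a : a ∈ E)
  right
  push Not at h1
  have h2 : ∀ p ∈ D, (p.1 = 1 ∨ p.1 = u) ∧ (1, p.2) ∈ D := by
    have key : ∀ a u : Perm (Fin 3), Perm.sign u = -1 → a * u * a⁻¹ = u → a = 1 ∨ a = u := by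
      decide
    intro p hp
    rcases key _ _ hu (h1 p hp) with h | h
    · exact ⟨Or.inl h, by rw [← h]; exact hp⟩
    · refine ⟨Or.inr h, ?_⟩
      have := D.mul_mem (D.inv_mem huD) hp
      simpa [Prod.mul_def, h] using this
  by_cases h3 : ∃ b, Perm.sign b = -1 ∧ (1, b) ∈ D
  · left
    obtain ⟨b, hb, hbD⟩ := h3
    have h4 : ∀ x, ((1, x⁻¹) ∈ D) ∨ (1, x⁻¹ * u) ∈ D := by
      intro x
      obtain ⟨p, hp, rfl⟩ := hD x
      obtain ⟨h | h, hp'⟩ := h2 p hp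
      · left; simpa [h] using hp'
      · right; simpa [h] using hp'
    let E := D.comap (MonoidHom.inr (Perm (Fin 3)) (Perm (Fin 3)))
    have hE : E = ⊤ := by
      by_contra hE
      have h5 : ∀ v ∈ E, Perm.sign v = -1 → v = b := fun v hv hvs => by
        by_contra hne
        exact hE (perm_three_generated_of_odd hvs hb hne hv hbD)
      have h6 (x) : x⁻¹ ∈ E ∨ x⁻¹ * u ∈ E := h4 x
      -- The 3-cycle `x` is chosen so that either alternative of `h6` puts a transposition other
      -- than `b` into `E`.
      have key : ∀ u b : Perm (Fin 3), Perm.sign u = -1 → Perm.sign b = -1 →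
        ∃ x, Perm.sign x = 1 ∧ x ≠ 1 ∧ x⁻¹ * u ≠ b ∧ x * b * x⁻¹ ≠ b := by decide
      obtain ⟨x, hx, -, hxu, hxb⟩ := key u b hu hb
      rcases h6 x with h | h
      · apply hxb
        have h' : x ∈ E := by simpa using E.inv_mem h
        exact h5 _ (E.mul_mem (E.mul_mem h' hbD) (E.inv_mem h')) (by simp [hb])
      · exact hxu (h5 _ h (by simp [hu, hx]))
    exact fun a => (hE ▸ mem_top a : a ∈ E)
  · right
    push Not at h3
    intro a ha
    obtain ⟨h | h, ha'⟩ := h2 _ ha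
    · exact h
    · exact absurd ha' (h3 a (by rw [← hu]; exact congrArg Perm.sign h))

theorem perm_three_prod {D : Subgroup (Perm (Fin 3) × Perm (Fin 3))}
    (hD : ∀ x, ∃ p ∈ D, p.1 * p.2⁻¹ = x) :
    (∀ a, (a, 1) ∈ D) ∨ (∀ b, (1, b) ∈ D) ∨ ∀ a, (a, a) ∈ D → a = 1 := by
  obtain ⟨p, hp, hps⟩ := hD (swap 0 1)
  -- Exactly one of `a`, `b` is odd. Cubing fixes transpositions and kills even elements, so `p ^ 3`
  -- is a transposition in a single factor.
  have key : ∀ a b : Perm (Fin 3), a * b⁻¹ = swap 0 1 →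
      (Perm.sign a = -1 ∧ a ^ 3 = a ∧ b ^ 3 = 1) ∨ (Perm.sign b = -1 ∧ b ^ 3 = b ∧ a ^ 3 = 1) := by
    decide
  rcases key _ _ hps with ⟨h1, h2, h3⟩ | ⟨h1, h2, h3⟩
  · refine perm_three_prod_of_odd_fst hD h1 ?_
    have := D.pow_mem hp 3
    rwa [← Prod.mk.eta (p := p), Prod.pow_mk, h2, h3] at this
  · have := perm_three_prod_of_odd_fst
      (D := D.comap (MulEquiv.prodComm : Perm (Fin 3) × Perm (Fin 3) ≃* _).toMonoidHom) (u := p.2)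
      (fun x => by
        obtain ⟨q, hq, hqx⟩ := hD x⁻¹
        exact ⟨q.swap, hq, by simp [← inv_inj (a := _ * _), ← hqx]⟩) h1 (by
        have := D.pow_mem hp 3
        rwa [← Prod.mk.eta (p := p), Prod.pow_mk, h2, h3] at this)
    rcases this with h | h | h
    exacts [Or.inr (Or.inl h), Or.inl h, Or.inr (Or.inr h)]

end PermFinThree

/-- Any two distinct transpositions are simultaneously conjugate to `(0 1)` and `(1 2)`, in order,
and these generate. -/
theorem exists_conj_of_perm_three_hom (φ : Perm (Fin 3) →* Perm (Fin 3))
    (hφ : Function.Injective φ) : ∃ c, ∀ a, φ a = c * a * c⁻¹ := by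
  have key : ∀ s t : Perm (Fin 3), Perm.sign s = -1 → Perm.sign t = -1 → s ≠ t →
      ∃ c : Perm (Fin 3), (c * swap 0 1 * c⁻¹, c * swap 1 2 * c⁻¹) = (s, t) := by decide
  have hodd (s : Perm (Fin 3)) (hs : s ^ 2 = 1) (hs1 : s ≠ 1) : Perm.sign (φ s) = -1 := by
    have key' : ∀ t : Perm (Fin 3), t ^ 2 = 1 → t ≠ 1 → Perm.sign t = -1 := by decide
    exact key' _ (by rw [← map_pow, hs, map_one]) (by rwa [Ne, map_eq_one_iff φ hφ])
  obtain ⟨c, hc⟩ := key (φ (swap 0 1)) (φ (swap 1 2)) (hodd _ (by decide) (by decide))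
    (hodd _ (by decide) (by decide)) (hφ.ne (by decide))
  obtain ⟨h1, h2⟩ := Prod.mk.inj hc
  refine ⟨c, fun a => ?_⟩
  have hE : φ.eqLocus (MulAut.conj c).toMonoidHom = ⊤ :=
    perm_three_generated_of_odd (u := swap 0 1) (v := swap 1 2) (by decide) (by decide) (by decide)
      (by simpa [MonoidHom.eqLocus] using h1.symm) (by simpa [MonoidHom.eqLocus] using h2.symm)
  exact (hE ▸ mem_top a : a ∈ φ.eqLocus (MulAut.conj c).toMonoidHom)

/-- Two-sided translations of a group `S`, transported along a bijection of sets. -/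
def twoSidedTranslation {S : Type*} [Group S] (pt : S ≃ X) : S × S →* Perm X :=
  pt.permCongrHom.toMonoidHom.comp
    { toFun := fun p => (Equiv.mulRight p.2⁻¹).trans (Equiv.mulLeft p.1)
      map_one' := by ext; simp
      map_mul' := fun p q => by ext; simp [mul_assoc] }

@[simp] theorem twoSidedTranslation_apply {S : Type*} [Group S] (pt : S ≃ X) (p : S × S) (a : S) :
    twoSidedTranslation pt p (pt a) = pt (p.1 * a * p.2⁻¹) := by
  simp [twoSidedTranslation, mul_assoc]

/-- Automorphisms of `S₃` are inner, so every element of `Γ` is a two-sided translation of `S₃`. By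
`perm_three_prod`, either `Γ` contains all left translations (that is, `N`), or all right
translations, or its point stabilizer is trivial and `Γ` is regular. -/
theorem hasRegularNormal_of_perm_three {N Γ : Subgroup (Perm X)}
    (hN : IsRegularSubgroup N) (h : Γ ≤ normalizer (N : Set _)) {x : X}
    (ht : ∀ y, ∃ g ∈ Γ, g x = y) (e : Perm (Fin 3) ≃* N) : HasRegularNormal Γ := by
  let pt : Perm (Fin 3) ≃ X := e.toEquiv.trans (hN.equiv x)
  have hpt (a) : pt a = (e a : Perm X) x := rfl
  have hx : pt 1 = x := by simp [hpt]
  let Φ := twoSidedTranslation pt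
  have hΦ (p a) : Φ p (pt a) = pt (p.1 * a * p.2⁻¹) := twoSidedTranslation_apply pt p a
  have hΦN (a) : Φ (a, 1) = e a := by
    ext y
    obtain ⟨b, rfl⟩ := pt.surjective y
    rw [hΦ, hpt b, ← Perm.mul_apply, ← Subgroup.coe_mul, ← map_mul, ← hpt]
    simp
  have hΓ : ∀ g ∈ Γ, ∃ p, Φ p = g := by
    intro g hg
    let φ : Perm (Fin 3) →* Perm (Fin 3) := (e.symm.toMonoidHom.comp
      (N.normalizerMonoidHom ⟨g, h hg⟩).toMonoidHom).comp e.toMonoidHom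
    have hφ : Function.Injective φ := by
      intro a b hab
      simpa [φ] using hab
    have hφe (a) : (e (φ a) : Perm X) = g * e a * g⁻¹ := by
      have : e (φ a) = N.normalizerMonoidHom ⟨g, h hg⟩ (e a) := by simp [φ]
      rw [this]; rfl
    obtain ⟨c, hc⟩ := exists_conj_of_perm_three_hom φ hφ
    obtain ⟨m, hm⟩ := pt.surjective (g x)
    -- Writing `m` for the image of the base point, `g` sends `a` to `(c a c⁻¹) m = c a (m⁻¹ c)⁻¹`.
    refine ⟨(c, m⁻¹ * c), ?_⟩
    ext y
    obtain ⟨a, rfl⟩ := pt.surjective y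
    have h1 : g (pt a) = (e (φ a) : Perm X) (g x) := by rw [hφe, hpt]; simp
    rw [h1, ← hm, hΦ, hpt m, ← Perm.mul_apply, ← Subgroup.coe_mul, ← map_mul, ← hpt, hc]
    simp [mul_assoc]
  have hD : ∀ a, ∃ p ∈ Γ.comap Φ, p.1 * p.2⁻¹ = a := by
    intro a
    obtain ⟨g, hg, hga⟩ := ht (pt a)
    obtain ⟨p, rfl⟩ := hΓ g hg
    refine ⟨p, hg, pt.injective ?_⟩
    rw [← hga, ← hx, hΦ, mul_one]
  rcases perm_three_prod hD with h1 | h1 | h1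
  · refine ⟨N, hN, h, fun n hn => ?_⟩
    have := h1 (e.symm ⟨n, hn⟩)
    rw [mem_comap, hΦN] at this
    simpa using this
  · refine ⟨(⊤ : Subgroup (Perm (Fin 3))).map (Φ.comp (MonoidHom.inr _ _)), ?_, ?_, ?_⟩
    · refine isRegularSubgroup_of_stabilizer_eq_one (x := x) (fun y => ?_) ?_
      · obtain ⟨b, rfl⟩ := pt.surjective y
        refine ⟨_, mem_map_of_mem _ (mem_top b⁻¹), ?_⟩
        rw [← hx]
        exact (hΦ _ _).trans (by simp)
      · rintro _ ⟨b, -, rfl⟩ hb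
        rw [← hx] at hb
        have := pt.injective ((hΦ (1, b) 1).symm.trans hb)
        have : b = 1 := by simpa using this
        rw [this, map_one]
    · intro g hg
      obtain ⟨⟨a, b⟩, rfl⟩ := hΓ g hg
      rw [mem_normalizer_iff]
      have hconj (a b c) : Φ (a, b) * Φ (1, c) * (Φ (a, b))⁻¹ = Φ (1, b * c * b⁻¹) := by
        rw [← map_inv, ← map_mul, ← map_mul]
        simp
      intro n
      constructor
      · rintro ⟨c, -, rfl⟩
        exact ⟨b * c * b⁻¹, mem_top _, (hconj a b c).symm⟩
      · rintro ⟨c, -, hc⟩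
        refine ⟨b⁻¹ * c * b, mem_top _, ?_⟩
        have := hconj a⁻¹ b⁻¹ c
        rw [show Φ (1, c) = _ from hc, ← Prod.inv_mk, map_inv, inv_inv, inv_inv] at this
        rw [show (Φ.comp (MonoidHom.inr _ _)) (b⁻¹ * c * b) = Φ (1, b⁻¹ * c * b) from rfl, ← this]
        group
    · rintro _ ⟨b, -, rfl⟩
      exact h1 b
  · refine hasRegularNormal_self (isRegularSubgroup_of_stabilizer_eq_one ht fun g hg hgx => ?_)
    obtain ⟨⟨a, b⟩, rfl⟩ := hΓ g hg
    rw [← hx, hΦ] at hgx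
    have hab : a * b⁻¹ = 1 := by simpa using pt.injective hgx
    rw [mul_inv_eq_one] at hab
    subst hab
    rw [h1 a hg]
    exact map_one Φ

/-- A transitive permutation group of degree less than `8` normalizing a regular subgroup contains
a regular subgroup that it normalizes. -/
theorem hasRegularNormal_of_card_lt_eight [Finite X] {N Γ : Subgroup (Perm X)}
    (hN : IsRegularSubgroup N) (h : Γ ≤ normalizer (N : Set _)) {x : X}
    (ht : ∀ y, ∃ g ∈ Γ, g x = y) (hX : Nat.card X < 8) : HasRegularNormal Γ := by
  have : Nonempty X := ⟨x⟩
  have h0 : 0 < Nat.card X := Nat.card_pos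
  by_cases hp : (Nat.card X).Prime
  · exact hasRegularNormal_of_card_prime hN h ht hp
  have h1 : Nat.card X = 1 ∨ Nat.card X = 4 ∨ Nat.card X = 6 := by
    generalize Nat.card X = n at *
    interval_cases n <;> revert hp <;> norm_num
  rcases h1 with h1 | h1 | h1
  · have : Subsingleton X := (Nat.card_eq_one_iff_unique.1 h1).1
    exact hasRegularNormal_self
      (isRegularSubgroup_of_stabilizer_eq_one ht fun g _ _ => Subsingleton.elim _ _)
  · exact hasRegularNormal_of_card_four hN h ht h1
  · rcases isCyclic_or_mulEquiv_perm_of_card_six ((hN.card_eq x).trans h1) with hc | ⟨⟨e⟩⟩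
    · exact hasRegularNormal_of_isCyclic hN h ht (by rw [h1]; decide)
    · exact hasRegularNormal_of_perm_three hN h ht e

end RegularSubgroups

/-! ### The action of the Galois group on embeddings -/

section Embeddings

open Equiv Subgroup

variable {k : Type*} {K L : Type*} [Field k] [Field K] [Field L] [Algebra k K] [Algebra k L]

variable (k K L) in
/-- The action of `Gal(L/k)` on the `k`-embeddings of `K` in `L` by composition. -/
def embeddingAction : Gal(L/k) →* Perm (K →ₐ[k] L) where
  toFun γ := AlgEquiv.arrowCongr AlgEquiv.refl γ
  map_one' := by ext; rfl
  map_mul' _ _ := by ext; rfl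

@[simp] theorem embeddingAction_apply (γ : Gal(L/k)) (σ : K →ₐ[k] L) (t : K) :
    embeddingAction k K L γ σ t = γ (σ t) := rfl

theorem exists_embeddingAction_eq [Normal k L] (σ τ : K →ₐ[k] L) :
    ∃ γ, embeddingAction k K L γ σ = τ := by
  let χ : σ.fieldRange ≃ₐ[k] τ.fieldRange :=
    (AlgEquiv.ofInjectiveField σ).symm.trans (AlgEquiv.ofInjectiveField τ)
  refine ⟨χ.liftNormal L, AlgHom.ext fun t => ?_⟩
  have h := χ.liftNormal_commutes L (AlgEquiv.ofInjectiveField σ t)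
  have hχ : χ (AlgEquiv.ofInjectiveField σ t) = AlgEquiv.ofInjectiveField τ t :=
    congrArg (AlgEquiv.ofInjectiveField τ) ((AlgEquiv.ofInjectiveField σ).symm_apply_apply t)
  rw [hχ] at h
  exact h

instance [FiniteDimensional k K] : Normal k (AlgebraicClosure K) :=
  have : Algebra.IsAlgebraic k (AlgebraicClosure K) := Algebra.IsAlgebraic.trans k K _
  have : IsAlgClosure k (AlgebraicClosure K) := ⟨inferInstance, this⟩
  IsAlgClosure.normal k _

variable (k K) in
/-- The cosets of `Gal(K̃/K)` correspond to the embeddings of `K` in `K̃`. -/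
noncomputable def cosetEquivEmbedding [FiniteDimensional k K] :
    Gal(GaloisClosure k K/k) ⧸ galoisClosureStabilizer k K ≃ (K →ₐ[k] GaloisClosure k K) :=
  Equiv.ofBijective
    (Quotient.lift
      (fun γ => embeddingAction k K _ γ (IsScalarTower.toAlgHom k K (GaloisClosure k K)))
      (by
        intro γ γ' h
        have h : γ⁻¹ * γ' ∈ galoisClosureStabilizer k K := QuotientGroup.leftRel_apply.1 h
        rw [galoisClosureStabilizer, IntermediateField.mem_fixingSubgroup_iff] at h
        refine AlgHom.ext fun t => ?_
        have h1 : γ⁻¹ (γ' (algebraMap K (GaloisClosure k K) t)) = algebraMap K _ t := h _ ⟨t, rfl⟩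
        rw [embeddingAction_apply, embeddingAction_apply]
        exact (congrArg γ h1.symm).trans (γ.apply_symm_apply _)))
    (by
      constructor
      · intro q q'
        induction q using QuotientGroup.induction_on with | H γ =>
        induction q' using QuotientGroup.induction_on with | H γ' =>
        intro h
        rw [QuotientGroup.eq, galoisClosureStabilizer, IntermediateField.mem_fixingSubgroup_iff]
        rintro _ ⟨t, rfl⟩
        have h1 : γ (algebraMap K _ t) = γ' (algebraMap K _ t) := DFunLike.congr_fun h t
        change γ⁻¹ (γ' (algebraMap K _ t)) = algebraMap K _ t
        rw [← h1]
        exact γ.symm_apply_apply _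
      · intro τ
        obtain ⟨γ, hγ⟩ := exists_embeddingAction_eq
          (IsScalarTower.toAlgHom k K (GaloisClosure k K)) τ
        exact ⟨γ, hγ⟩)

theorem cosetEquivEmbedding_cosetAction [FiniteDimensional k K] (γ : Gal(GaloisClosure k K/k))
    (q : Gal(GaloisClosure k K/k) ⧸ galoisClosureStabilizer k K) :
    cosetEquivEmbedding k K (cosetAction _ γ q) =
      embeddingAction k K _ γ (cosetEquivEmbedding k K q) := by
  induction q using QuotientGroup.induction_on with | H γ' =>
  rfl

theorem isRegularSubgroup_map_permCongr {X : Type u} {Y : Type v} (e : X ≃ Y)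
    {N : Subgroup (Perm X)} (hN : IsRegularSubgroup N) :
    IsRegularSubgroup (N.map e.permCongrHom.toMonoidHom) := by
  intro y z
  obtain ⟨σ, ⟨hσ, hσx⟩, huniq⟩ := hN (e.symm y) (e.symm z)
  refine ⟨e.permCongr σ, ⟨⟨σ, hσ, rfl⟩, by simp [hσx]⟩, ?_⟩
  rintro _ ⟨⟨τ, hτ, rfl⟩, hτy⟩
  rw [← huniq τ ⟨hτ, by rw [← hτy]; simp⟩]
  rfl

theorem HasRegularNormal.map_permCongr {X : Type u} {Y : Type v} (e : X ≃ Y)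
    {Γ : Subgroup (Perm X)} (h : HasRegularNormal Γ) :
    HasRegularNormal (Γ.map e.permCongrHom.toMonoidHom) := by
  obtain ⟨N, h1, h2, h3⟩ := h
  exact ⟨_, isRegularSubgroup_map_permCongr e h1,
    (Subgroup.map_mono h2).trans (le_normalizer_map _),
    Subgroup.map_mono h3⟩

/-- Almost classically Galois extensions in terms of the action of the Galois group on the
embeddings in the Galois closure. -/
theorem isAlmostClassicallyGalois_iff [FiniteDimensional k K] :
    IsAlmostClassicallyGalois k K ↔
      HasRegularNormal (embeddingAction k K (GaloisClosure k K)).range := by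
  change HasRegularNormal (cosetAction (galoisClosureStabilizer k K)).range ↔ _
  have h : (embeddingAction k K (GaloisClosure k K)).range =
      (cosetAction (galoisClosureStabilizer k K)).range.map
        (cosetEquivEmbedding k K).permCongrHom.toMonoidHom := by
    rw [MonoidHom.map_range]
    congr 1
    ext γ σ t
    obtain ⟨q, rfl⟩ := (cosetEquivEmbedding k K).surjective σ
    simp [Equiv.permCongrHom, cosetEquivEmbedding_cosetAction]
  have h' : (embeddingAction k K (GaloisClosure k K)).range.map
        (cosetEquivEmbedding k K).symm.permCongrHom.toMonoidHom =
      (cosetAction (galoisClosureStabilizer k K)).range := by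
    rw [h, Subgroup.map_map]
    convert Subgroup.map_id _
    ext
    simp [Equiv.permCongrHom]
  exact ⟨fun hN => h ▸ HasRegularNormal.map_permCongr (cosetEquivEmbedding k K) hN,
    fun hN => h' ▸ HasRegularNormal.map_permCongr (cosetEquivEmbedding k K).symm hN⟩

theorem card_embedding [FiniteDimensional k K] [Algebra.IsSeparable k K] :
    Nat.card (K →ₐ[k] GaloisClosure k K) = Module.finrank k K := by
  refine AlgHom.natCard_of_splits k K _ fun x => ?_
  rw [← minpoly.algebraMap_eq (algebraMap K (GaloisClosure k K)).injective x]
  exact Normal.splits inferInstance _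

end Embeddings

/-! ### From Hopf Galois structures to regular subgroups -/

section HopfToRegular

open Coalgebra

variable {k : Type u} {K H : Type v} {L : Type w} [Field k] [Field K] [Field L] [Algebra k K]
  [Algebra k L]

section Action

variable [Ring H] [Algebra k H]

variable (L) in
/-- The right action of `L ⊗ H` on `Hom_k(K, L)`: `(φ · (a ⊗ h))(t) = a φ(h t)`. -/
noncomputable def homAction (μ : H →ₐ[k] Module.End k K) (φ : K →ₗ[k] L) :
    L ⊗[k] H →ₗ[L] (K →ₗ[k] L) :=
  LinearMap.liftBaseChange L (LinearMap.llcomp k K K L φ ∘ₗ μ.toLinearMap)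

@[simp] theorem homAction_tmul (μ : H →ₐ[k] Module.End k K) (φ : K →ₗ[k] L) (a : L) (h : H)
    (t : K) : homAction L μ φ (a ⊗ₜ h) t = a * φ (μ h t) := by
  simp [homAction]

theorem homAction_add_left (μ : H →ₐ[k] Module.End k K) (φ ψ : K →ₗ[k] L) (x : L ⊗[k] H) :
    homAction L μ (φ + ψ) x = homAction L μ φ x + homAction L μ ψ x := by
  induction x with
  | zero => simp
  | add x₁ x₂ h₁ h₂ => rw [map_add, h₁, h₂, map_add, map_add, add_add_add_comm]
  | tmul a h => ext t; simp [mul_add]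

theorem homAction_mul (μ : H →ₐ[k] Module.End k K) (φ : K →ₗ[k] L) (x y : L ⊗[k] H) :
    homAction L μ φ (x * y) = homAction L μ (homAction L μ φ x) y := by
  induction y with
  | zero => simp
  | add y₁ y₂ h₁ h₂ => rw [mul_add, map_add, h₁, h₂, map_add]
  | tmul b g =>
    induction x with
    | zero => ext; simp
    | add x₁ x₂ h₁ h₂ => rw [add_mul, map_add, h₁, h₂, map_add, homAction_add_left]
    | tmul a h => ext t; simp [mul_assoc, mul_left_comm]

theorem homAction_one (μ : H →ₐ[k] Module.End k K) (φ : K →ₗ[k] L) :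
    homAction L μ φ 1 = φ := by
  ext t
  simp [Algebra.TensorProduct.one_def]

theorem comp_homAction (μ : H →ₐ[k] Module.End k K) (γ : L →ₐ[k] L) (φ : K →ₗ[k] L)
    (x : L ⊗[k] H) : γ.toLinearMap ∘ₗ homAction L μ φ x =
      homAction L μ (γ.toLinearMap ∘ₗ φ) (TensorProduct.map γ.toLinearMap .id x) := by
  induction x with
  | zero => simp
  | add x₁ x₂ h₁ h₂ => rw [map_add, LinearMap.comp_add, h₁, h₂, map_add, map_add]
  | tmul a h => ext t; simp

theorem embeddingAction_toLinearMap (γ : Gal(L/k)) (σ : K →ₐ[k] L) :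
    (embeddingAction k K L γ σ).toLinearMap = γ.toAlgHom.toLinearMap ∘ₗ σ.toLinearMap := rfl

end Action

section Hopf

variable [Ring H] [HopfAlgebra k H] {μ : H →ₐ[k] Module.End k K}

theorem homAction_apply_one (hμ : IsModuleAlgebraAction k K μ) (σ : K →ₐ[k] L) (x : L ⊗[k] H) :
    homAction L μ σ.toLinearMap x 1 = counit (R := L) x := by
  induction x with
  | zero => simp
  | add x₁ x₂ h₁ h₂ => simp [h₁, h₂]
  | tmul a h => simp [hμ.map_one, Algebra.smul_def, mul_comm]

/-- Evaluation at `(s, t)` on the tensor square of `Hom_k(K, L)`. -/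
noncomputable def evalTensor (s t : K) : (K →ₗ[k] L) ⊗[L] (K →ₗ[k] L) →ₗ[L] L :=
  LinearMap.mul' L L ∘ₗ TensorProduct.map (LinearMap.applyₗ' L s) (LinearMap.applyₗ' L t)

@[simp] theorem evalTensor_tmul (s t : K) (φ ψ : K →ₗ[k] L) :
    evalTensor s t (φ ⊗ₜ[L] ψ) = φ s * ψ t := rfl

theorem homAction_apply_mul (hμ : IsModuleAlgebraAction k K μ) (σ : K →ₐ[k] L) (x : L ⊗[k] H)
    (s t : K) : homAction L μ σ.toLinearMap x (s * t) =
      evalTensor s t (TensorProduct.map (homAction L μ σ.toLinearMap)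
        (homAction L μ σ.toLinearMap) (comul (R := L) x)) := by
  induction x with
  | zero => simp
  | add x₁ x₂ h₁ h₂ => simp only [map_add, LinearMap.add_apply, h₁, h₂]
  | tmul a h =>
    rw [TensorProduct.comul_tmul, homAction_tmul, hμ.map_mul, ← (ℛ k h).eq]
    simp [TensorProduct.tmul_sum, map_sum, Finset.mul_sum, mul_left_comm]

/-- The evaluations at pairs of basis vectors are the coordinates with respect to the tensor
products of the dual basis. -/
theorem eq_zero_of_evalTensor [FiniteDimensional k K]
    {z : (K →ₗ[k] L) ⊗[L] (K →ₗ[k] L)} (hz : ∀ s t, evalTensor s t z = 0) : z = 0 := by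
  let b := Module.finBasis k K
  let e (i) : K →ₗ[k] L := Algebra.linearMap k L ∘ₗ b.coord i
  have he (φ : K →ₗ[k] L) : φ = ∑ i, φ (b i) • e i := by
    refine b.ext fun j => ?_
    simp [e, Finsupp.single_apply]
  have key (z : (K →ₗ[k] L) ⊗[L] (K →ₗ[k] L)) :
      z = ∑ i, ∑ j, evalTensor (b i) (b j) z • (e i ⊗ₜ[L] e j) := by
    induction z with
    | zero => simp
    | add x y hx hy =>
      refine (congrArg₂ (· + ·) hx hy).trans ?_
      simp only [map_add, add_smul, Finset.sum_add_distrib]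
    | tmul φ ψ =>
      conv_lhs => rw [he φ, he ψ, sum_tmul]
      simp_rw [tmul_sum, smul_tmul_smul, evalTensor_tmul]
  rw [key z]
  simp [hz]

theorem finrank_eq_of_hopfGaloisMap_bijective [FiniteDimensional k K]
    (hj : Function.Bijective (hopfGaloisMap k K μ)) : Module.finrank k H = Module.finrank k K := by
  have h := (LinearEquiv.ofBijective _ hj).finrank_eq
  rw [Module.finrank_tensorProduct, Module.finrank_linearMap] at h
  exact Nat.eq_of_mul_eq_mul_left Module.finrank_pos h

/-- Surjectivity of `j` puts `σ ∘ E` in the image for every `E ∈ End_k(K)`, and these maps span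
`Hom_k(K, L)` over `L`. Equality of dimensions gives injectivity. -/
theorem homAction_bijective [FiniteDimensional k K] [Module.Finite k H]
    (hj : Function.Bijective (hopfGaloisMap k K μ)) (σ : K →ₐ[k] L) :
    Function.Bijective (homAction L μ σ.toLinearMap) := by
  have hsurj : Function.Surjective (homAction L μ σ.toLinearMap) := by
    have h1 (E : Module.End k K) : σ.toLinearMap ∘ₗ E ∈
        LinearMap.range (homAction L μ σ.toLinearMap) := by
      obtain ⟨w, rfl⟩ := hj.2 E
      induction w with
      | zero => simp
      | add x y hx hy => rw [map_add, LinearMap.comp_add]; exact Submodule.add_mem _ hx hy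
      | tmul s h =>
        refine ⟨σ s ⊗ₜ h, ?_⟩
        ext t
        simp [hopfGaloisMap_tmul]
    intro φ
    let b := Module.finBasis k K
    have he : φ = ∑ i, φ (b i) • (σ.toLinearMap ∘ₗ (Algebra.linearMap k K ∘ₗ b.coord i)) := by
      refine b.ext fun j => ?_
      simp [Finsupp.single_apply]
    rw [he]
    exact Submodule.sum_mem _ fun i _ => Submodule.smul_mem _ _ (h1 _)
  refine ⟨?_, hsurj⟩
  rwa [LinearMap.injective_iff_surjective_of_finrank_eq_finrank]
  rw [Module.finrank_baseChange, Module.finrank_linearMap_self,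
    finrank_eq_of_hopfGaloisMap_bijective hj]

/-- The module algebra axioms turn comultiplication into evaluation on products. Since `τ (s t) = τ
s τ t`, both `Δ x` and `x ⊗ x` have the same evaluations after the injective map `σ · (-)` on both
factors. -/
theorem isGroupLikeElem_of_homAction_eq [FiniteDimensional k K] [Module.Finite k H]
    (hμ : IsModuleAlgebraAction k K μ) (hj : Function.Bijective (hopfGaloisMap k K μ))
    {σ τ : K →ₐ[k] L} {x : L ⊗[k] H} (hx : homAction L μ σ.toLinearMap x = τ.toLinearMap) :
    IsGroupLikeElem L x where
  counit_eq_one := by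
    rw [← homAction_apply_one hμ σ, hx]
    exact map_one τ
  comul_eq_tmul_self := by
    let Φ := LinearEquiv.ofBijective _ (homAction_bijective hj σ)
    have hΦ : ∀ y, TensorProduct.congr Φ Φ y = TensorProduct.map (homAction L μ σ.toLinearMap)
        (homAction L μ σ.toLinearMap) y := fun y => rfl
    refine (TensorProduct.congr Φ Φ).injective (sub_eq_zero.1 (eq_zero_of_evalTensor fun s t => ?_))
    rw [map_sub, hΦ, hΦ, ← homAction_apply_mul hμ σ, map_tmul, hx, evalTensor_tmul]
    exact sub_eq_zero.2 (map_mul τ s t)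

theorem exists_homAction_eq_of_isGroupLikeElem (hμ : IsModuleAlgebraAction k K μ)
    {x : L ⊗[k] H} (hx : IsGroupLikeElem L x) (σ : K →ₐ[k] L) :
    ∃ τ : K →ₐ[k] L, τ.toLinearMap = homAction L μ σ.toLinearMap x :=
  ⟨AlgHom.ofLinearMap (homAction L μ σ.toLinearMap x)
    (by rw [homAction_apply_one hμ, hx.counit_eq_one])
    (fun s t => by
      rw [homAction_apply_mul hμ, hx.comul_eq_tmul_self, map_tmul, evalTensor_tmul]), rfl⟩

open Equiv in
/-- A Hopf Galois structure yields a regular group of permutations of the embeddings of `K` in a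
normal extension, normalized by the Galois group. -/
theorem exists_isRegularSubgroup_of_isHopfGalois [FiniteDimensional k K] (h : IsHopfGalois k K)
    (L : Type w) [Field L] [Algebra k L] [Nonempty (K →ₐ[k] L)] :
    ∃ N : Subgroup (Perm (K →ₐ[k] L)), IsRegularSubgroup N ∧
      (embeddingAction k K L).range ≤ Subgroup.normalizer (N : Set _) := by
  obtain ⟨H, _, _, _, -, μ, hμ, hj⟩ := h
  let N : Subgroup (Perm (K →ₐ[k] L)) :=
    { carrier := {p | ∃ x : L ⊗[k] H, IsGroupLikeElem L x ∧
        ∀ σ : K →ₐ[k] L, (p σ).toLinearMap = homAction L μ σ.toLinearMap x}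
      one_mem' := ⟨1, .one, fun σ => (homAction_one μ _).symm⟩
      mul_mem' := by
        rintro p q ⟨x, hx, hp⟩ ⟨y, hy, hq⟩
        -- The order is reversed because `L ⊗ H` acts on the right.
        refine ⟨y * x, hy.mul hx, fun σ => ?_⟩
        rw [homAction_mul, ← hq, ← hp]
        rfl
      inv_mem' := by
        rintro p ⟨x, hx, hp⟩
        refine ⟨_, hx.antipode, fun σ => ?_⟩
        have := hp (p⁻¹ σ)
        rw [show p (p⁻¹ σ) = σ from p.apply_symm_apply σ] at this
        rw [this, ← homAction_mul, hx.mul_antipode_cancel, homAction_one] }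
  have hN : IsRegularSubgroup N := by
    intro σ τ
    obtain ⟨x, hx⟩ := (homAction_bijective hj σ).2 τ.toLinearMap
    have hg := isGroupLikeElem_of_homAction_eq hμ hj hx
    choose f hf using exists_homAction_eq_of_isGroupLikeElem (L := L) hμ hg
    choose f' hf' using exists_homAction_eq_of_isGroupLikeElem (L := L) hμ hg.antipode
    refine ⟨⟨f, f', fun ρ => ?_, fun ρ => ?_⟩, ⟨⟨x, hg, hf⟩, ?_⟩, ?_⟩
    · apply AlgHom.toLinearMap_injective
      rw [hf', hf, ← homAction_mul, hg.mul_antipode_cancel, homAction_one]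
    · apply AlgHom.toLinearMap_injective
      rw [hf, hf', ← homAction_mul, hg.antipode_mul_cancel, homAction_one]
    · exact AlgHom.toLinearMap_injective ((hf σ).trans hx)
    · rintro p ⟨⟨y, hy, hp⟩, rfl⟩
      ext1 ρ
      apply AlgHom.toLinearMap_injective
      exact ((hp ρ).trans (by rw [(homAction_bijective hj σ).1 (hx.trans (hp σ))])).trans
        (hf ρ).symm
  have hmem : ∀ γ : Gal(L/k), ∀ p ∈ N,
      embeddingAction k K L γ * p * (embeddingAction k K L γ)⁻¹ ∈ N := by
    rintro γ p ⟨x, hx, hp⟩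
    have h1 (σ : K →ₐ[k] L) :
        ((embeddingAction k K L γ * p * (embeddingAction k K L γ)⁻¹) σ).toLinearMap =
          homAction L μ σ.toLinearMap (TensorProduct.map γ.toAlgHom.toLinearMap .id x) := by
      obtain ⟨ρ, rfl⟩ := (embeddingAction k K L γ).surjective σ
      have h2 : (embeddingAction k K L γ * p * (embeddingAction k K L γ)⁻¹)
          (embeddingAction k K L γ ρ) = embeddingAction k K L γ (p ρ) := by
        simp only [Perm.mul_apply, Perm.inv_def, Equiv.symm_apply_apply]
      rw [h2, embeddingAction_toLinearMap, embeddingAction_toLinearMap, hp, comp_homAction]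
    -- The conjugate by `γ` acts through the Galois conjugate of `x`. This is group-like simply
    -- because it carries an embedding to an embedding.
    refine ⟨_, ?_, h1⟩
    exact isGroupLikeElem_of_homAction_eq hμ hj (h1 (Classical.arbitrary _)).symm
  refine ⟨N, hN, ?_⟩
  rintro _ ⟨γ, rfl⟩
  rw [Subgroup.mem_normalizer_iff]
  refine fun p => ⟨hmem γ p, fun hp => ?_⟩
  have := hmem γ⁻¹ _ hp
  rw [map_inv] at this
  simpa [mul_assoc] using this

end Hopf

/-- A separable Hopf Galois extension of degree less than `8` is almost classically Galois. -/
theorem isAlmostClassicallyGalois_of_finrank_lt_eight {k : Type u} {K : Type v} [Field k] [Field K]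
    [Algebra k K] [FiniteDimensional k K] [Algebra.IsSeparable k K]
    (hn : Module.finrank k K < 8) (h : IsHopfGalois k K) : IsAlmostClassicallyGalois k K := by
  let σ : K →ₐ[k] GaloisClosure k K := IsScalarTower.toAlgHom k K (GaloisClosure k K)
  have : Nonempty (K →ₐ[k] GaloisClosure k K) := ⟨σ⟩
  obtain ⟨N, hN, hnorm⟩ := exists_isRegularSubgroup_of_isHopfGalois h (GaloisClosure k K)
  rw [isAlmostClassicallyGalois_iff]
  refine hasRegularNormal_of_card_lt_eight hN hnorm (x := σ) (fun τ => ?_) ?_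
  · obtain ⟨γ, hγ⟩ := exists_embeddingAction_eq σ τ
    exact ⟨_, ⟨γ, rfl⟩, hγ⟩
  · rwa [card_embedding]

end HopfToRegular

/-! ### Descent of Hopf algebras -/

section Forms

variable {k L : Type*} [Field k] [Field L] [Algebra k L]

/-! ### Forms of vector spaces and of their tensor products -/

section Modules

variable {V W V' W' : Type*} [AddCommGroup V] [Module k V] [AddCommGroup W] [Module k W]
  [Module L W] [IsScalarTower k L W] [AddCommGroup V'] [Module k V'] [AddCommGroup W'] [Module k W']
  [Module L W'] [IsScalarTower k L W']

variable (L) in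
/-- A `k`-linear map to an `L`-module that sends a basis to a basis, so that it identifies the
source with a `k`-form of the target. -/
def IsFormMap (f : V →ₗ[k] W) : Prop :=
  ∃ (ι : Type) (b : Module.Basis ι k V) (b' : Module.Basis ι L W), ∀ i, f (b i) = b' i

theorem IsFormMap.repr_apply {f : V →ₗ[k] W} {ι : Type} {b : Module.Basis ι k V}
    {b' : Module.Basis ι L W} (h : ∀ i, f (b i) = b' i) (x : V) (i : ι) :
    b'.repr (f x) i = algebraMap k L (b.repr x i) := by
  have : (LinearMap.restrictScalars k (b'.coord i)) ∘ₗ f = Algebra.linearMap k L ∘ₗ b.coord i :=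
    b.ext fun j => by
      classical
      simp [h, Finsupp.single_apply, apply_ite]
  exact LinearMap.congr_fun this x

theorem IsFormMap.injective {f : V →ₗ[k] W} (h : IsFormMap L f) : Function.Injective f := by
  obtain ⟨ι, b, b', hb⟩ := h
  intro x y hxy
  refine b.ext_elem fun i => (algebraMap k L).injective ?_
  rw [← repr_apply hb, hxy, repr_apply hb]

variable (L) in
/-- The map `V ⊗[k] V' → W ⊗[L] W'` induced by `k`-linear maps `V → W` and `V' → W'`. -/
noncomputable def formTensor (f : V →ₗ[k] W) (g : V' →ₗ[k] W') : V ⊗[k] V' →ₗ[k] W ⊗[L] W' :=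
  TensorProduct.lift (LinearMap.mk₂ k (fun x y => f x ⊗ₜ[L] g y)
    (fun x y z => by rw [map_add, add_tmul])
    (fun c x y => by rw [map_smul, smul_tmul'])
    (fun x y z => by rw [map_add, tmul_add])
    (fun c x y => by
      rw [map_smul, ← algebraMap_smul L c (g y), tmul_smul, algebraMap_smul]))

@[simp] theorem formTensor_tmul (f : V →ₗ[k] W) (g : V' →ₗ[k] W') (x : V) (y : V') :
    formTensor L f g (x ⊗ₜ y) = f x ⊗ₜ g y := rfl

theorem IsFormMap.tensor {f : V →ₗ[k] W} {g : V' →ₗ[k] W'} (hf : IsFormMap L f)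
    (hg : IsFormMap L g) : IsFormMap L (formTensor L f g) := by
  obtain ⟨ι, b, b', hb⟩ := hf
  obtain ⟨κ, c, c', hc⟩ := hg
  exact ⟨ι × κ, b.tensorProduct c, b'.tensorProduct c', fun ⟨i, j⟩ => by
    simp [hb, hc]⟩

theorem formTensor_assoc {V'' W'' : Type*} [AddCommGroup V''] [Module k V''] [AddCommGroup W'']
    [Module k W''] [Module L W''] [IsScalarTower k L W''] (f : V →ₗ[k] W) (g : V' →ₗ[k] W')
    (h : V'' →ₗ[k] W'') (z : (V ⊗[k] V') ⊗[k] V'') :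
    TensorProduct.assoc L W W' W'' (formTensor L (formTensor L f g) h z) =
      formTensor L f (formTensor L g h) (TensorProduct.assoc k V V' V'' z) := by
  induction z with
  | zero => simp
  | add x y hx hy => simp only [map_add, hx, hy]
  | tmul x y =>
    induction x with
    | zero => simp
    | add x x' hx hx' => simp only [map_add, add_tmul, hx, hx']
    | tmul x x' => simp

theorem formTensor_map {V₁ V₁' W₁ W₁' : Type*} [AddCommGroup V₁] [Module k V₁] [AddCommGroup W₁]
    [Module k W₁] [Module L W₁] [IsScalarTower k L W₁] [AddCommGroup V₁'] [Module k V₁']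
    [AddCommGroup W₁'] [Module k W₁'] [Module L W₁'] [IsScalarTower k L W₁']
    {f : V →ₗ[k] W} {g : V' →ₗ[k] W'} {f₁ : V₁ →ₗ[k] W₁} {g₁ : V₁' →ₗ[k] W₁'}
    {p : V →ₗ[k] V₁} {P : W →ₗ[L] W₁} {q : V' →ₗ[k] V₁'} {Q : W' →ₗ[L] W₁'}
    (hp : ∀ x, f₁ (p x) = P (f x)) (hq : ∀ x, g₁ (q x) = Q (g x)) (z : V ⊗[k] V') :
    formTensor L f₁ g₁ (TensorProduct.map p q z) = TensorProduct.map P Q (formTensor L f g z) := by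
  induction z with
  | zero => simp
  | add x y hx hy => simp only [map_add, hx, hy]
  | tmul x y => simp [hp, hq]

theorem IsFormMap.exists_lift {U : Type*} [AddCommGroup U] [Module k U] {j : V →ₗ[k] W}
    (hj : IsFormMap L j) (f : U →ₗ[k] W) (hf : ∀ u, f u ∈ LinearMap.range j) :
    ∃ g : U →ₗ[k] V, ∀ u, j (g u) = f u := by
  refine ⟨(LinearEquiv.ofInjective j hj.injective).symm ∘ₗ f.codRestrict _ hf, fun u => ?_⟩
  exact congrArg Subtype.val
    ((LinearEquiv.ofInjective j hj.injective).apply_symm_apply (f.codRestrict _ hf u))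

end Modules

variable (k L) in
theorem isFormMap_linearMap : IsFormMap L (Algebra.linearMap k L) :=
  ⟨Unit, Module.Basis.singleton Unit k, Module.Basis.singleton Unit L, by simp⟩

/-! ### Restricting a Hopf algebra structure to a form -/

section Subalgebra

variable {A : Type*} [Ring A] [HopfAlgebra L A] [Algebra k A] [IsScalarTower k L A]

open Coalgebra HopfAlgebra

variable (L) in
/-- A `k`-subalgebra of a Hopf algebra over `L` which is a `k`-form stable under the Hopf algebra
operations. -/
structure IsHopfForm (H : Subalgebra k A) : Prop where
  isFormMap : IsFormMap L H.val.toLinearMap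
  comul_mem : ∀ h : H, comul (R := L) (h : A) ∈
    LinearMap.range (formTensor L H.val.toLinearMap H.val.toLinearMap)
  counit_mem : ∀ h : H, counit (R := L) (h : A) ∈ LinearMap.range (Algebra.linearMap k L)
  antipode_mem : ∀ h : H, antipode L (h : A) ∈ H

theorem formTensor_val_mul (H : Subalgebra k A) (x y : H ⊗[k] H) :
    formTensor L H.val.toLinearMap H.val.toLinearMap (x * y) =
      formTensor L H.val.toLinearMap H.val.toLinearMap x *
        formTensor L H.val.toLinearMap H.val.toLinearMap y := by
  induction x with
  | zero => simp
  | add x x' hx hx' => rw [add_mul, map_add, hx, hx', map_add, add_mul]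
  | tmul a b =>
    induction y with
    | zero => simp
    | add x x' hx hx' => rw [mul_add, map_add, hx, hx', map_add, mul_add]
    | tmul c d => simp

namespace IsHopfForm

variable {H : Subalgebra k A}

theorem exists_comul (hH : IsHopfForm L H) : ∃ Δ : H →ₗ[k] H ⊗[k] H, ∀ h,
    formTensor L H.val.toLinearMap H.val.toLinearMap (Δ h) = comul (R := L) (h : A) :=
  (hH.isFormMap.tensor hH.isFormMap).exists_lift
    ((comul (R := L) (A := A)).restrictScalars k ∘ₗ H.val.toLinearMap) hH.comul_mem

theorem exists_counit (hH : IsHopfForm L H) :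
    ∃ ε : H →ₗ[k] k, ∀ h, algebraMap k L (ε h) = counit (R := L) (h : A) :=
  (isFormMap_linearMap k L).exists_lift
    ((counit (R := L) (A := A)).restrictScalars k ∘ₗ H.val.toLinearMap) hH.counit_mem

/-- The comultiplication of a Hopf form. -/
noncomputable def comulAlgHom (hH : IsHopfForm L H) : H →ₐ[k] H ⊗[k] H :=
  AlgHom.ofLinearMap hH.exists_comul.choose
    ((hH.isFormMap.tensor hH.isFormMap).injective (by
      rw [hH.exists_comul.choose_spec, OneMemClass.coe_one, Bialgebra.comul_one,
        Algebra.TensorProduct.one_def, Algebra.TensorProduct.one_def, formTensor_tmul]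
      rfl))
    (fun x y => (hH.isFormMap.tensor hH.isFormMap).injective (by
      rw [hH.exists_comul.choose_spec, MulMemClass.coe_mul, Bialgebra.comul_mul, formTensor_val_mul,
        hH.exists_comul.choose_spec, hH.exists_comul.choose_spec]))

theorem formTensor_comulAlgHom (hH : IsHopfForm L H) (h : H) :
    formTensor L H.val.toLinearMap H.val.toLinearMap (hH.comulAlgHom h) = comul (R := L) (h : A) := hH.exists_comul.choose_spec h

/-- The counit of a Hopf form. -/
noncomputable def counitAlgHom (hH : IsHopfForm L H) : H →ₐ[k] k :=
  AlgHom.ofLinearMap hH.exists_counit.choose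
    ((algebraMap k L).injective (by
      rw [hH.exists_counit.choose_spec, OneMemClass.coe_one, Bialgebra.counit_one, map_one]))
    (fun x y => (algebraMap k L).injective (by
      rw [hH.exists_counit.choose_spec, MulMemClass.coe_mul, Bialgebra.counit_mul, map_mul,
        hH.exists_counit.choose_spec, hH.exists_counit.choose_spec]))

theorem algebraMap_counitAlgHom (hH : IsHopfForm L H) (h : H) :
    algebraMap k L (hH.counitAlgHom h) = counit (R := L) (h : A) := hH.exists_counit.choose_spec h

/-- The bialgebra structure on a Hopf form. -/
noncomputable abbrev bialgebra (hH : IsHopfForm L H) : Bialgebra k H :=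
  Bialgebra.ofAlgHom hH.comulAlgHom hH.counitAlgHom
    (by
      have hi := hH.isFormMap
      -- Tensor powers of the form embed in those of `A`, so each axiom reduces to the same axiom in
      -- `A`.
      refine AlgHom.ext fun h => (hi.tensor (hi.tensor hi)).injective ?_
      have h1 := formTensor_map (L := L) (f := H.val.toLinearMap) (g := H.val.toLinearMap)
        (f₁ := formTensor L H.val.toLinearMap H.val.toLinearMap) (g₁ := H.val.toLinearMap)
        (p := hH.comulAlgHom.toLinearMap) (q := LinearMap.id) (P := comul (R := L))
        (Q := LinearMap.id) hH.formTensor_comulAlgHom (fun _ => rfl) (hH.comulAlgHom h)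
      have h2 := formTensor_map (L := L) (f := H.val.toLinearMap) (g := H.val.toLinearMap)
        (f₁ := H.val.toLinearMap) (g₁ := formTensor L H.val.toLinearMap H.val.toLinearMap)
        (q := hH.comulAlgHom.toLinearMap) (p := LinearMap.id) (Q := comul (R := L))
        (P := LinearMap.id) (fun _ => rfl) hH.formTensor_comulAlgHom (hH.comulAlgHom h)
      have h3 := formTensor_assoc (L := L) H.val.toLinearMap H.val.toLinearMap H.val.toLinearMap
        (TensorProduct.map hH.comulAlgHom.toLinearMap LinearMap.id (hH.comulAlgHom h))
      rw [h1, formTensor_comulAlgHom] at h3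
      rw [formTensor_comulAlgHom] at h2
      exact h3.symm.trans ((Coalgebra.coassoc_apply (R := L) (h : A)).trans h2.symm))
    (by
      have hi := hH.isFormMap
      refine AlgHom.ext fun h => ((isFormMap_linearMap k L).tensor hi).injective ?_
      have h1 := formTensor_map (L := L) (f := H.val.toLinearMap) (g := H.val.toLinearMap)
        (f₁ := Algebra.linearMap k L) (g₁ := H.val.toLinearMap)
        (p := hH.counitAlgHom.toLinearMap) (q := LinearMap.id) (P := counit (R := L))
        (Q := LinearMap.id) hH.algebraMap_counitAlgHom (fun _ => rfl) (hH.comulAlgHom h)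
      rw [formTensor_comulAlgHom] at h1
      refine h1.trans ((Coalgebra.rTensor_counit_comul (R := L) (h : A)).trans ?_)
      simp [Algebra.TensorProduct.lid_symm_apply])
    (by
      have hi := hH.isFormMap
      refine AlgHom.ext fun h => (hi.tensor (isFormMap_linearMap k L)).injective ?_
      have h1 := formTensor_map (L := L) (f := H.val.toLinearMap) (g := H.val.toLinearMap)
        (f₁ := H.val.toLinearMap) (g₁ := Algebra.linearMap k L)
        (q := hH.counitAlgHom.toLinearMap) (p := LinearMap.id) (Q := counit (R := L))
        (P := LinearMap.id) (fun _ => rfl) hH.algebraMap_counitAlgHom (hH.comulAlgHom h)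
      rw [formTensor_comulAlgHom] at h1
      refine h1.trans ((Coalgebra.lTensor_counit_comul (R := L) (h : A)).trans ?_)
      simp [Algebra.TensorProduct.rid_symm_apply])

/-- The antipode of a Hopf form. -/
noncomputable def antipodeLinearMap (hH : IsHopfForm L H) : H →ₗ[k] H :=
  (((antipode L).restrictScalars k) ∘ₗ H.val.toLinearMap).codRestrict H.toSubmodule hH.antipode_mem

theorem val_mul' (z : H ⊗[k] H) : (LinearMap.mul' k H z : A) =
    LinearMap.mul' L A (formTensor L H.val.toLinearMap H.val.toLinearMap z) := by
  induction z with
  | zero => simp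
  | add x y hx hy => rw [map_add, AddMemClass.coe_add, hx, hy, map_add, map_add]
  | tmul x y => simp

/-- The Hopf algebra structure on a Hopf form. -/
noncomputable abbrev hopfAlgebra (hH : IsHopfForm L H) : HopfAlgebra k H :=
  { hH.bialgebra with
    antipode := hH.antipodeLinearMap
    mul_antipode_rTensor_comul := by
      refine LinearMap.ext fun h => Subtype.ext ?_
      have h1 := formTensor_map (L := L) (f := H.val.toLinearMap) (g := H.val.toLinearMap)
        (f₁ := H.val.toLinearMap) (g₁ := H.val.toLinearMap)
        (p := hH.antipodeLinearMap) (q := LinearMap.id) (P := antipode L)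
        (Q := LinearMap.id) (fun _ => rfl) (fun _ => rfl) (hH.comulAlgHom h)
      rw [formTensor_comulAlgHom] at h1
      refine (val_mul' _).trans ((congrArg (LinearMap.mul' L A) h1).trans ?_)
      refine (mul_antipode_rTensor_comul_apply (R := L) (h : A)).trans ?_
      rw [← hH.algebraMap_counitAlgHom, ← IsScalarTower.algebraMap_apply]
      rfl
    mul_antipode_lTensor_comul := by
      refine LinearMap.ext fun h => Subtype.ext ?_
      have h1 := formTensor_map (L := L) (f := H.val.toLinearMap) (g := H.val.toLinearMap)
        (f₁ := H.val.toLinearMap) (g₁ := H.val.toLinearMap)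
        (q := hH.antipodeLinearMap) (p := LinearMap.id) (Q := antipode L)
        (P := LinearMap.id) (fun _ => rfl) (fun _ => rfl) (hH.comulAlgHom h)
      rw [formTensor_comulAlgHom] at h1
      refine (val_mul' _).trans ((congrArg (LinearMap.mul' L A) h1).trans ?_)
      refine (mul_antipode_lTensor_comul_apply (R := L) (h : A)).trans ?_
      rw [← hH.algebraMap_counitAlgHom, ← IsScalarTower.algebraMap_apply]
      rfl }

theorem isCocomm [IsCocomm L A] (hH : IsHopfForm L H) :
    letI := hH.hopfAlgebra; IsCocomm k H := by
  let := hH.hopfAlgebra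
  refine ⟨LinearMap.ext fun h => (hH.isFormMap.tensor hH.isFormMap).injective ?_⟩
  have key (z : H ⊗[k] H) : formTensor L H.val.toLinearMap H.val.toLinearMap
      (TensorProduct.comm k H H z) =
      TensorProduct.comm L A A (formTensor L H.val.toLinearMap H.val.toLinearMap z) := by
    induction z with
    | zero => simp
    | add x y hx hy => simp only [map_add, hx, hy]
    | tmul x y => simp
  refine (key _).trans ?_
  change TensorProduct.comm L A A (formTensor L _ _ (hH.comulAlgHom h)) =
    formTensor L _ _ (hH.comulAlgHom h)
  rw [formTensor_comulAlgHom, comm_comul]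

end IsHopfForm

end Subalgebra

end Forms

/-! ### Twisted forms of group algebras -/

section TwistedGroupAlgebra

open Coalgebra HopfAlgebra

variable {k L N : Type*} [Field k] [Field L] [Algebra k L]

section Coeff

variable (L) in
/-- Reading off a coefficient. -/
noncomputable def coeffLinearMap (n : N) : MonoidAlgebra L N →ₗ[L] L :=
  Finsupp.lapply n ∘ₗ (MonoidAlgebra.coeffLinearEquiv L).toLinearMap

@[simp] theorem coeffLinearMap_apply (n : N) (x : MonoidAlgebra L N) :
    coeffLinearMap L n x = x.coeff n := rfl

/-- The basis of a group algebra given by the group elements. -/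
noncomputable def groupBasis (L N : Type*) [Field L] : Module.Basis N L (MonoidAlgebra L N) :=
  .ofRepr (MonoidAlgebra.coeffLinearEquiv L)

theorem groupBasis_repr (x : MonoidAlgebra L N) (n : N) :
    (groupBasis L N).repr x n = x.coeff n := rfl

variable (L) in
/-- Reading off a coefficient in the tensor square of a group algebra. -/
noncomputable def coeffTensor (n m : N) : MonoidAlgebra L N ⊗[L] MonoidAlgebra L N →ₗ[L] L :=
  LinearMap.mul' L L ∘ₗ TensorProduct.map (coeffLinearMap L n) (coeffLinearMap L m)

@[simp] theorem coeffTensor_tmul (n m : N) (x y : MonoidAlgebra L N) :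
    coeffTensor L n m (x ⊗ₜ y) = x.coeff n * y.coeff m := rfl

theorem coeffTensor_ext {z z' : MonoidAlgebra L N ⊗[L] MonoidAlgebra L N}
    (h : ∀ n m, coeffTensor L n m z = coeffTensor L n m z') : z = z' := by
  have key (z : MonoidAlgebra L N ⊗[L] MonoidAlgebra L N) (n m : N) :
      ((groupBasis L N).tensorProduct (groupBasis L N)).repr z (n, m) = coeffTensor L n m z := by
    induction z with
    | zero => simp
    | add x y hx hy => simp only [map_add, Finsupp.add_apply, hx, hy]
    | tmul x y => simp [groupBasis_repr, mul_comm]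
  refine ((groupBasis L N).tensorProduct (groupBasis L N)).ext_elem fun ⟨n, m⟩ => ?_
  rw [key, key, h]

theorem coeffTensor_comul [DecidableEq N] (n m : N) (x : MonoidAlgebra L N) :
    coeffTensor L n m (comul (R := L) x) = if n = m then x.coeff n else 0 := by
  induction x using MonoidAlgebra.induction_linear with
  | zero => simp
  | add x y hx hy => simp only [map_add, hx, hy]; split_ifs <;> simp
  | single g r =>
    simp [Finsupp.single_apply]
    split_ifs <;> simp_all

end Coeff

variable [Group N]

/-- The semilinear action of a Galois automorphism on a group algebra. -/
noncomputable def twistedAction (c : Gal(L/k) →* MulAut N) (γ : Gal(L/k)) :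
    MonoidAlgebra L N →+* MonoidAlgebra L N :=
  (MonoidAlgebra.mapDomainRingEquiv L (c γ)).toRingHom.comp
    (MonoidAlgebra.mapRingHom N (γ : L →+* L))

theorem coeff_twistedAction (c : Gal(L/k) →* MulAut N) (γ : Gal(L/k)) (x : MonoidAlgebra L N)
    (n : N) : (twistedAction c γ x).coeff (c γ n) = γ (x.coeff n) := by
  simp [twistedAction]

/-- The `k`-algebra of invariants of a group algebra `L[N]` under the action of `Gal(L/k)` twisted
by an action on `N`. -/
noncomputable def twistedGroupAlgebra (c : Gal(L/k) →* MulAut N) :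
    Subalgebra k (MonoidAlgebra L N) where
  carrier := {x | ∀ γ, twistedAction c γ x = x}
  mul_mem' hx hy γ := by rw [map_mul, hx, hy]
  add_mem' hx hy γ := by rw [map_add, hx, hy]
  algebraMap_mem' r γ := by simp [twistedAction]

theorem mem_twistedGroupAlgebra {c : Gal(L/k) →* MulAut N} {x : MonoidAlgebra L N} :
    x ∈ twistedGroupAlgebra c ↔ ∀ γ n, x.coeff (c γ n) = γ (x.coeff n) := by
  refine ⟨fun h γ n => ?_, fun h γ => MonoidAlgebra.ext (Finsupp.ext fun n => ?_)⟩
  · conv_lhs => rw [← h γ]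
    exact coeff_twistedAction c γ x n
  · obtain ⟨n, rfl⟩ := (c γ).surjective n
    rw [coeff_twistedAction, h]

variable [FiniteDimensional k L]

/-- A functional `F` vanishing on the invariants kills every orbit sum `∑ γ(a) c(γ)(n)`, so `∑
F(c(γ)(n)) γ = 0`. Dedekind independence of automorphisms gives `F(n) = 0` at `γ = 1`. -/
theorem span_twistedGroupAlgebra (c : Gal(L/k) →* MulAut N) :
    Submodule.span L (twistedGroupAlgebra c : Set (MonoidAlgebra L N)) = ⊤ := by
  by_contra hne
  obtain ⟨F, hF, hle⟩ := Submodule.exists_le_ker_of_lt_top _ (lt_top_iff_ne_top.2 hne)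
  apply hF
  have hker (x) (hx : x ∈ twistedGroupAlgebra c) : F x = 0 := hle (Submodule.subset_span hx)
  have key (n : N) : F (MonoidAlgebra.single n 1) = 0 := by
    have h1 : ∑ γ : Gal(L/k), F (MonoidAlgebra.single (c γ n) 1) • γ.toAlgHom.toLinearMap = 0 := by
      refine LinearMap.ext fun a => ?_
      rw [LinearMap.zero_apply, ← hker (∑ γ : Gal(L/k), MonoidAlgebra.single (c γ n) (γ a)) ?_, map_sum]
      · simp only [LinearMap.sum_apply, LinearMap.smul_apply]
        refine Finset.sum_congr rfl fun γ _ => ?_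
        rw [← mul_one (γ a), ← smul_eq_mul, ← MonoidAlgebra.smul_single, map_smul, smul_eq_mul,
          smul_eq_mul, mul_comm]
        rfl
      · intro τ
        rw [map_sum]
        refine Fintype.sum_equiv (Equiv.mulLeft τ) _ _ fun γ => ?_
        simp [twistedAction]
    have h2 := linearIndependent_toLinearMap k L L
    have h3 : LinearIndependent L fun γ : Gal(L/k) => γ.toAlgHom.toLinearMap :=
      h2.comp (fun γ : Gal(L/k) => γ.toAlgHom) fun γ τ h => AlgEquiv.ext fun a =>
        (DFunLike.congr_fun h a : γ.toAlgHom a = τ.toAlgHom a)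
    simpa using (Fintype.linearIndependent_iff.1 h3) _ h1 1
  refine LinearMap.toAddMonoidHom_injective (MonoidAlgebra.addMonoidHom_ext fun n r => ?_)
  have : MonoidAlgebra.single n r = r • MonoidAlgebra.single n (1 : L) := by simp
  simp only [LinearMap.toAddMonoidHom_coe, this, map_smul, key, smul_zero, LinearMap.zero_apply]

/-- Multiply a relation `∑ lᵢ bᵢ = 0` by `m` and sum its Galois conjugates: `∑ Tr(m lᵢ) bᵢ = 0`. So
these traces vanish for all `m`, and the trace form is nondegenerate. -/
theorem linearIndependent_of_twistedGroupAlgebra [IsGalois k L] (c : Gal(L/k) →* MulAut N)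
    {ι : Type*} [Fintype ι]
    {b : ι → twistedGroupAlgebra c} (hb : LinearIndependent k b) :
    LinearIndependent L fun i => (b i : MonoidAlgebra L N) := by
  rw [Fintype.linearIndependent_iff] at hb ⊢
  intro l hl
  have h1 (m : L) (i : ι) : Algebra.trace k L (m * l i) = 0 := by
    refine hb (fun i => Algebra.trace k L (m * l i)) (Subtype.ext ?_) i
    have h2 : ∀ γ : Gal(L/k), ∑ i, γ (m * l i) • (b i : MonoidAlgebra L N) = 0 := by
      intro γ
      have := congrArg (twistedAction c γ) (congrArg (m • ·) hl)
      simp only [Finset.smul_sum, smul_zero, map_zero, map_sum] at this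
      rw [← this]
      refine Finset.sum_congr rfl fun i _ => ?_
      refine MonoidAlgebra.ext (Finsupp.ext fun n => ?_)
      obtain ⟨n, rfl⟩ := (c γ).surjective n
      rw [coeff_twistedAction]
      simp [mem_twistedGroupAlgebra.1 (b i).2 γ n, mul_assoc]
    have h3 : ∑ i, algebraMap k L (Algebra.trace k L (m * l i)) • (b i : MonoidAlgebra L N) = 0 := by
      simp_rw [trace_eq_sum_automorphisms, Finset.sum_smul]
      rw [Finset.sum_comm]
      exact Finset.sum_eq_zero fun γ _ => h2 γ
    simpa [algebraMap_smul] using h3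
  intro i
  exact (traceForm_nondegenerate k L).1 (l i) fun m => by
    rw [Algebra.traceForm_apply, mul_comm]; exact h1 m i

variable [IsGalois k L] [Finite N]

theorem isFormMap_twistedGroupAlgebra (c : Gal(L/k) →* MulAut N) :
    IsFormMap L (twistedGroupAlgebra c).val.toLinearMap := by
  have : Module.Finite L (MonoidAlgebra L N) := .of_basis (groupBasis L N)
  have : Module.Finite k (MonoidAlgebra L N) := .trans L _
  let b := Module.finBasis k (twistedGroupAlgebra c)
  have hspan : ⊤ ≤ Submodule.span L (Set.range fun i => (b i : MonoidAlgebra L N)) := by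
    rw [← span_twistedGroupAlgebra c, Submodule.span_le]
    intro x hx
    have h1 : (⟨x, hx⟩ : twistedGroupAlgebra c) = ∑ i, b.repr ⟨x, hx⟩ i • b i :=
      (b.sum_repr _).symm
    have h2 : x = ∑ i, b.repr ⟨x, hx⟩ i • (b i : MonoidAlgebra L N) := by
      have h2 := congrArg (twistedGroupAlgebra c).val h1
      simp only [map_sum, map_smul] at h2
      exact h2
    rw [h2]
    refine Submodule.sum_mem _ fun i _ => ?_
    rw [← algebraMap_smul L]
    exact Submodule.smul_mem _ _ (Submodule.subset_span ⟨i, rfl⟩)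
  exact ⟨_, b, .mk (linearIndependent_of_twistedGroupAlgebra c b.linearIndependent) hspan,
    fun i => by simp⟩

theorem isHopfForm_twistedGroupAlgebra (c : Gal(L/k) →* MulAut N) :
    IsHopfForm L (twistedGroupAlgebra c) where
  isFormMap := isFormMap_twistedGroupAlgebra c
  comul_mem := by
    classical
    intro h
    obtain ⟨ι, b, b', hb⟩ := isFormMap_twistedGroupAlgebra c
    have : Module.Finite L (MonoidAlgebra L N) := .of_basis (groupBasis L N)
    have : Fintype ι := FiniteDimensional.fintypeBasisIndex b'
    have hb (i) : b' i = (b i : MonoidAlgebra L N) := (hb i).symm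
    let B := b'.tensorProduct b'
    have hB (i) : B i = (b i.1 : MonoidAlgebra L N) ⊗ₜ[L] (b i.2 : MonoidAlgebra L N) := by
      rw [← hb, ← hb]
      exact Module.Basis.tensorProduct_apply' _ _ _
    let z := comul (R := L) (h : MonoidAlgebra L N)
    have hz : z = ∑ i, B.repr z i • B i := (B.sum_repr z).symm
    -- Both `z` and the basis `B` are Galois invariant, so the coordinates of `z` are fixed by `γ`
    -- and lie in `k`.
    have hfix (γ : Gal(L/k)) : z = ∑ i, γ (B.repr z i) • B i := by
      refine coeffTensor_ext fun n m => ?_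
      obtain ⟨n, rfl⟩ := (c γ).surjective n
      obtain ⟨m, rfl⟩ := (c γ).surjective m
      have h1 := congrArg γ (congrArg (coeffTensor L n m) hz)
      have h2 : coeffTensor L (c γ n) (c γ m) z = γ (coeffTensor L n m z) := by
        rw [coeffTensor_comul, coeffTensor_comul, mem_twistedGroupAlgebra.1 h.2]
        simp [(c γ).injective.eq_iff, apply_ite γ]
      rw [h2, h1]
      simp only [map_sum, map_smul, hB, coeffTensor_tmul, smul_eq_mul, map_mul,
        mem_twistedGroupAlgebra.1 (Subtype.mem (b _))]
    have hk (i) : ∃ r, algebraMap k L r = B.repr z i := by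
      refine (IsGalois.mem_range_algebraMap_iff_fixed _).2 fun γ => ?_
      have := congrArg (fun w => B.repr w i) (hfix γ)
      simpa [Finsupp.single_apply] using this.symm
    choose r hr using hk
    refine ⟨∑ i, r i • (b i.1 ⊗ₜ b i.2), ?_⟩
    change _ = z
    rw [hz, map_sum]
    refine Finset.sum_congr rfl fun i _ => ?_
    rw [map_smul, formTensor_tmul, ← hr, algebraMap_smul, hB]
    rfl
  counit_mem h := by
    have : Fintype N := Fintype.ofFinite N
    have key (x : MonoidAlgebra L N) : counit (R := L) x = ∑ n, x.coeff n := by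
      classical
      induction x using MonoidAlgebra.induction_linear with
      | zero => simp
      | add x y hx hy => simp only [map_add, hx, hy]; simp [Finset.sum_add_distrib]
      | single g r => simp [Finsupp.single_apply]
    refine (IsGalois.mem_range_algebraMap_iff_fixed _).2 fun γ => ?_
    rw [key, map_sum]
    exact Fintype.sum_equiv (c γ).toEquiv _ _ fun n => (mem_twistedGroupAlgebra.1 h.2 γ n).symm
  antipode_mem h := by
    have key (x : MonoidAlgebra L N) (n : N) : (antipode L x).coeff n = x.coeff n⁻¹ := by
      classical
      induction x using MonoidAlgebra.induction_linear with
      | zero => simp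
      | add x y hx hy => simp [hx, hy]
      | single g r => simp [Finsupp.single_apply, inv_eq_iff_eq_inv]
    refine mem_twistedGroupAlgebra.2 fun γ n => ?_
    rw [key, key, ← map_inv, mem_twistedGroupAlgebra.1 h.2]

end TwistedGroupAlgebra

/-! ### From regular subgroups to Hopf Galois structures -/

section RegularToHopf

open Equiv Coalgebra HopfAlgebra

variable {k : Type u} {K L : Type v} [Field k] [Field K] [Field L] [Algebra k K] [Algebra k L]
  {N : Subgroup (Perm (K →ₐ[k] L))}

/-- The action of `Gal(L/k)` on a group of permutations of the embeddings that it normalizes. -/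
noncomputable def conjAction
    (hN : (embeddingAction k K L).range ≤ Subgroup.normalizer (N : Set (Perm (K →ₐ[k] L)))) :
    Gal(L/k) →* MulAut N :=
  N.normalizerMonoidHom.comp
    ((embeddingAction k K L).codRestrict (Subgroup.normalizer (N : Set (Perm (K →ₐ[k] L))))
      fun γ => hN ⟨γ, rfl⟩)

theorem coe_conjAction
    (hN : (embeddingAction k K L).range ≤ Subgroup.normalizer (N : Set (Perm (K →ₐ[k] L))))
    (γ : Gal(L/k)) (n : N) : (conjAction hN γ n : Perm (K →ₐ[k] L)) =
      embeddingAction k K L γ * n * (embeddingAction k K L γ)⁻¹ := rfl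

variable [Fintype N]

/-- The pairing `(∑ aₙ n, t) ↦ ∑ aₙ (n⁻¹ σ)(t)`. -/
noncomputable def embeddingPairing (N : Subgroup (Perm (K →ₐ[k] L))) [Fintype N] (σ : K →ₐ[k] L)
    (t : K) : MonoidAlgebra L N →ₗ[L] L :=
  ∑ n : N, ((n⁻¹ : N) : Perm (K →ₐ[k] L)) σ t • coeffLinearMap L n

theorem embeddingPairing_apply (σ : K →ₐ[k] L) (t : K) (x : MonoidAlgebra L N) :
    embeddingPairing N σ t x = ∑ n : N, ((n⁻¹ : N) : Perm (K →ₐ[k] L)) σ t * x.coeff n := by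
  simp [embeddingPairing]

@[simp] theorem embeddingPairing_single (σ : K →ₐ[k] L) (t : K) (n : N) (r : L) :
    embeddingPairing N σ t (MonoidAlgebra.single n r) =
      ((n⁻¹ : N) : Perm (K →ₐ[k] L)) σ t * r := by
  classical
  simp [embeddingPairing_apply, Finsupp.single_apply]

theorem embeddingPairing_one (σ : K →ₐ[k] L) (x : MonoidAlgebra L N) :
    embeddingPairing N σ 1 x = counit (R := L) x := by
  induction x using MonoidAlgebra.induction_linear with
  | zero => simp
  | add x y hx hy => rw [map_add, map_add, hx, hy]
  | single g r => simp

theorem embeddingPairing_mul (σ : K →ₐ[k] L) (s t : K) (x : MonoidAlgebra L N) :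
    embeddingPairing N σ (s * t) x = LinearMap.mul' L L
      (TensorProduct.map (embeddingPairing N σ s) (embeddingPairing N σ t)
        (comul (R := L) x)) := by
  induction x using MonoidAlgebra.induction_linear with
  | zero => simp
  | add x y hx hy => simp only [map_add, hx, hy]
  | single g r => simp [mul_assoc]

theorem embeddingPairing_conjAction
    (hN : (embeddingAction k K L).range ≤ Subgroup.normalizer (N : Set (Perm (K →ₐ[k] L))))
    {x : MonoidAlgebra L N} (hx : x ∈ twistedGroupAlgebra (conjAction hN)) (γ : Gal(L/k))
    (σ : K →ₐ[k] L) (t : K) : embeddingPairing N (embeddingAction k K L γ σ) t x =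
      γ (embeddingPairing N σ t x) := by
  rw [embeddingPairing_apply, embeddingPairing_apply, map_sum]
  refine (Fintype.sum_equiv (conjAction hN γ).toEquiv _ _ fun n => ?_).symm
  rw [map_mul, ← mem_twistedGroupAlgebra.1 hx, ← embeddingAction_apply γ]
  congr 2
  change _ = ((conjAction hN γ n)⁻¹ : N).1 _
  rw [← map_inv, coe_conjAction, Perm.mul_apply, Perm.mul_apply, Perm.inv_def (embeddingAction _ _ _ γ),
    Equiv.symm_apply_apply]

/-- By equivariance the value at `σ₀` is fixed by the automorphisms fixing `σ₀(K)`, hence lies in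
`σ₀(K)`. Transitivity of the Galois group carries the identity to every other `σ`. The resulting `s`
defines the action on `K`. -/
theorem exists_forall_apply_eq_embeddingPairing [FiniteDimensional k L] [IsGalois k L]
    (hN : (embeddingAction k K L).range ≤ Subgroup.normalizer (N : Set (Perm (K →ₐ[k] L))))
    {x : MonoidAlgebra L N} (hx : x ∈ twistedGroupAlgebra (conjAction hN)) (t : K) :
    ∃ s : K, ∀ σ : K →ₐ[k] L, σ s = embeddingPairing N σ t x := by
  by_cases hne : Nonempty (K →ₐ[k] L)
  · obtain ⟨σ₀⟩ := hne
    have h1 : embeddingPairing N σ₀ t x ∈ σ₀.fieldRange := by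
      rw [← IsGalois.fixedField_fixingSubgroup σ₀.fieldRange]
      refine (IntermediateField.mem_fixedField_iff σ₀.fieldRange.fixingSubgroup _).2 fun γ hγ => ?_
      have h2 : embeddingAction k K L γ σ₀ = σ₀ := AlgHom.ext fun a =>
        (IntermediateField.mem_fixingSubgroup_iff σ₀.fieldRange γ).1 hγ _ ⟨a, rfl⟩
      change γ _ = _
      rw [← embeddingPairing_conjAction hN hx, h2]
    obtain ⟨s, hs⟩ := h1
    refine ⟨s, fun σ => ?_⟩
    obtain ⟨γ, rfl⟩ := exists_embeddingAction_eq σ₀ σ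
    rw [embeddingPairing_conjAction hN hx, embeddingAction_apply]
    exact congrArg γ hs
  · exact ⟨0, fun σ => (hne ⟨σ⟩).elim⟩

theorem embeddingPairing_single_mul (σ : K →ₐ[k] L) (t : K) (g : N) (r : L)
    (y : MonoidAlgebra L N) :
    embeddingPairing N (((g⁻¹ : N) : Perm (K →ₐ[k] L)) σ) t y * r =
      embeddingPairing N σ t (MonoidAlgebra.single g r * y) := by
  induction y using MonoidAlgebra.induction_linear with
  | zero => simp
  | add x y hx hy => simp only [map_add, add_mul, mul_add, hx, hy]
  | single g' r' => simp [mul_assoc, mul_comm]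

theorem embeddingPairing_mul_left (σ : K →ₐ[k] L) {t s : K} {y : MonoidAlgebra L N}
    (hs : ∀ σ : K →ₐ[k] L, σ s = embeddingPairing N σ t y) (x : MonoidAlgebra L N) :
    embeddingPairing N σ s x = embeddingPairing N σ t (x * y) := by
  induction x using MonoidAlgebra.induction_linear with
  | zero => simp
  | add x y hx hy => simp only [map_add, add_mul, hx, hy]
  | single g r => rw [embeddingPairing_single, hs, embeddingPairing_single_mul]

/-- Regularity makes the embeddings `n⁻¹ σ` distinct, hence linearly independent over `L`. -/
theorem embeddingPairing_eq_zero {σ : K →ₐ[k] L} (hN : IsRegularSubgroup N)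
    {x : MonoidAlgebra L N} (hx : ∀ t, embeddingPairing N σ t x = 0) : x = 0 := by
  have h1 : LinearIndependent L fun n : N =>
      AlgHom.toLinearMap (((n⁻¹ : N) : Perm (K →ₐ[k] L)) σ) :=
    (linearIndependent_toLinearMap k K L).comp
      (fun n : N => ((n⁻¹ : N) : Perm (K →ₐ[k] L)) σ) fun n m h =>
        inv_injective (Subtype.ext ((hN σ _).unique ⟨(n⁻¹ : N).2, rfl⟩ ⟨(m⁻¹ : N).2, h.symm⟩))
  refine MonoidAlgebra.ext (Finsupp.ext fun n => ?_)
  refine Fintype.linearIndependent_iff.1 h1 (fun n => x.coeff n) (LinearMap.ext fun t => ?_) n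
  rw [LinearMap.zero_apply, ← hx t, embeddingPairing_apply]
  simp [mul_comm]

section FormAction

variable {A : Type v} [Ring A] [HopfAlgebra L A] [Algebra k A] [IsScalarTower k L A]
  {H : Subalgebra k A}

theorem IsHopfForm.isModuleAlgebraAction (hH : IsHopfForm L H) (σ : K →ₐ[k] L)
    (P : K → A →ₗ[L] L) (hmul : ∀ s t x, P (s * t) x = LinearMap.mul' L L
      (TensorProduct.map (P s) (P t) (comul (R := L) x)))
    (hone : ∀ x, P 1 x = counit (R := L) x) :
    letI := hH.hopfAlgebra
    ∀ μ : H →ₐ[k] Module.End k K, (∀ h t, σ (μ h t) = P t h) → IsModuleAlgebraAction k K μ := by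
  let := hH.hopfAlgebra
  refine fun μ hμ => ⟨fun h s t => σ.toRingHom.injective ?_, fun h => σ.toRingHom.injective ?_⟩
  · change σ _ = σ (LinearMap.mul' k K (TensorProduct.map _ _ (hH.comulAlgHom h)))
    rw [hμ, hmul, ← hH.formTensor_comulAlgHom]
    induction hH.comulAlgHom h with
    | zero => simp
    | add x y hx hy => simp only [map_add, hx, hy]
    | tmul x y => simp [hμ]
  · change σ _ = σ (algebraMap k K (hH.counitAlgHom h))
    rw [hμ, hone, ← hH.algebraMap_counitAlgHom, AlgHom.commutes]

/-- The map `s ⊗ h ↦ σ(s) h` into `A` is injective, as seen in matching bases, and `P` recovers `σ ∘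
j(w)` from the image of `w`. -/
theorem IsHopfForm.injective_hopfGaloisMap (hH : IsHopfForm L H) (σ : K →ₐ[k] L)
    (P : K → A →ₗ[L] L) (hP : ∀ x, (∀ t, P t x = 0) → x = 0) :
    letI := hH.hopfAlgebra
    ∀ μ : H →ₐ[k] Module.End k K, (∀ h t, σ (μ h t) = P t h) →
      Function.Injective (hopfGaloisMap k K μ) := by
  let := hH.hopfAlgebra
  intro μ hμ
  obtain ⟨ι, b, b', hb⟩ := hH.isFormMap
  let Φ : K ⊗[k] H →ₗ[k] A := TensorProduct.lift
    (((LinearMap.lsmul L A).restrictScalars₁₂ k k).compl₁₂ σ.toLinearMap H.val.toLinearMap)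
  have hΦ (s : K) (h : H) : Φ (s ⊗ₜ h) = σ s • (h : A) := rfl
  have hΦj (w : K ⊗[k] H) (t : K) : P t (Φ w) = σ (hopfGaloisMap k K μ w t) := by
    induction w with
    | zero => simp
    | add x y hx hy => simp only [map_add, LinearMap.add_apply, hx, hy]
    | tmul s h => rw [hΦ, map_smul, hopfGaloisMap_tmul, map_mul, hμ, smul_eq_mul]
  have hΦb (w : K ⊗[k] H) (i : ι) : b'.repr (Φ w) i = σ ((b.baseChange K).repr w i) := by
    induction w with
    | zero => simp
    | add x y hx hy => simp only [map_add, Finsupp.add_apply, hx, hy]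
    | tmul s h =>
      rw [hΦ, map_smul, Module.Basis.baseChange_repr_tmul, map_smul, Finsupp.smul_apply]
      have := IsFormMap.repr_apply hb h i
      rw [AlgHom.toLinearMap_apply, Subalgebra.coe_val] at this
      rw [this, Algebra.smul_def (b.repr h i), smul_eq_mul, mul_comm]
  refine (injective_iff_map_eq_zero _).2 fun w hw => ?_
  have h1 : Φ w = 0 := hP _ fun t => by rw [hΦj, hw, LinearMap.zero_apply, map_zero]
  refine (b.baseChange K).ext_elem fun i => σ.toRingHom.injective ?_
  change σ _ = σ _
  rw [← hΦb, h1]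
  simp

end FormAction

theorem exists_algHom_twistedGroupAlgebra [FiniteDimensional k L] [IsGalois k L] (σ₀ : K →ₐ[k] L)
    (hN : (embeddingAction k K L).range ≤ Subgroup.normalizer (N : Set (Perm (K →ₐ[k] L)))) :
    ∃ μ : twistedGroupAlgebra (conjAction hN) →ₐ[k] Module.End k K,
      ∀ h t, σ₀ (μ h t) = embeddingPairing N σ₀ t h := by
  choose m hm using fun h : twistedGroupAlgebra (conjAction hN) =>
    exists_forall_apply_eq_embeddingPairing hN h.2
  have ext {a b : K} (h : σ₀ a = σ₀ b) : a = b := σ₀.toRingHom.injective h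
  refine ⟨AlgHom.ofLinearMap
    { toFun h :=
        { toFun := m h
          map_add' s t := ext (by
            simp only [map_add, hm, embeddingPairing_apply, add_mul, Finset.sum_add_distrib])
          map_smul' a t := ext (by
            simp only [map_smul, hm, embeddingPairing_apply, RingHom.id_apply, Finset.smul_sum,
              smul_mul_assoc]) }
      map_add' x y := LinearMap.ext fun t => ext (by
        change σ₀ (m _ t) = σ₀ (m _ t + m _ t)
        rw [map_add, hm, hm, hm, ← map_add]
        rfl)
      map_smul' a x := LinearMap.ext fun t => ext (by
        change σ₀ (m _ t) = σ₀ (a • m _ t)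
        rw [map_smul, hm, hm, ← algebraMap_smul L a (embeddingPairing N σ₀ t _), ← map_smul,
          algebraMap_smul]
        rfl) }
    (LinearMap.ext fun t => ext (by
      change σ₀ (m 1 t) = σ₀ t
      rw [hm, OneMemClass.coe_one, MonoidAlgebra.one_def, embeddingPairing_single]
      simp))
    (fun x y => LinearMap.ext fun t => ext (by
      change σ₀ (m (x * y) t) = σ₀ (m x (m y t))
      rw [hm, hm, embeddingPairing_mul_left σ₀ (fun σ => hm y t σ)]
      rfl)), fun h t => hm h t σ₀⟩

/-- The Hopf algebra attached by Greither and Pareigis to a regular subgroup normalized by the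
Galois group. -/
theorem isHopfGalois_of_isRegularSubgroup [FiniteDimensional k K] [FiniteDimensional k L]
    [IsGalois k L] (σ₀ : K →ₐ[k] L) (hreg : IsRegularSubgroup N)
    (hN : (embeddingAction k K L).range ≤ Subgroup.normalizer (N : Set (Perm (K →ₐ[k] L)))) :
    IsHopfGalois k K := by
  have hH := isHopfForm_twistedGroupAlgebra (conjAction hN)
  let := hH.hopfAlgebra
  obtain ⟨μ, hμ⟩ := exists_algHom_twistedGroupAlgebra σ₀ hN
  obtain ⟨ι, b, b', hb⟩ := hH.isFormMap
  have : Module.Finite L (MonoidAlgebra L N) := .of_basis (groupBasis L N)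
  have : Fintype ι := FiniteDimensional.fintypeBasisIndex b'
  have hfin : Module.Finite k (twistedGroupAlgebra (conjAction hN)) := .of_basis b
  have hj := hH.injective_hopfGaloisMap σ₀ (embeddingPairing N σ₀)
    (fun _ => embeddingPairing_eq_zero hreg) μ hμ
  refine ⟨twistedGroupAlgebra (conjAction hN), inferInstance, hH.hopfAlgebra, hfin, hH.isCocomm, μ,
    hH.isModuleAlgebraAction σ₀ _ (embeddingPairing_mul σ₀) (embeddingPairing_one σ₀) μ hμ, hj, ?_⟩
  have : Algebra.IsSeparable k K := Algebra.IsSeparable.of_algHom k L σ₀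
  -- Both equal `|N|`, which is the number of embeddings; injectivity of `j` then suffices.
  have hcard : Module.finrank k (twistedGroupAlgebra (conjAction hN)) = Module.finrank k K := by
    rw [Module.finrank_eq_card_basis b, ← Module.finrank_eq_card_basis b',
      Module.finrank_eq_card_basis (groupBasis L N), ← Nat.card_eq_fintype_card,
      hreg.card_eq σ₀, AlgHom.natCard_of_splits]
    intro x
    rw [← minpoly.algHom_eq σ₀ σ₀.toRingHom.injective]
    exact Normal.splits inferInstance _
  refine (LinearMap.injective_iff_surjective_of_finrank_eq_finrank ?_).1 hj
  rw [Module.finrank_tensorProduct, hcard, Module.finrank_linearMap]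

end RegularToHopf

/-! ### The action of `S₄` on eight points -/

section PermFour

open Equiv Subgroup

/-- The action of `Perm α × β` on `α × β`, the group `β` acting by left translations. -/
def prodPerm (α β : Type*) [Group β] : Perm α × β →* Perm (α × β) where
  toFun p := Equiv.prodCongr p.1 (Equiv.mulLeft p.2)
  map_one' := by ext <;> simp
  map_mul' p q := by ext <;> simp [mul_assoc]

@[simp] theorem prodPerm_apply {α β : Type*} [Group β] (p : Perm α × β) (x : α × β) :
    prodPerm α β p x = (p.1 x.1, p.2 * x.2) := rfl

/-- The action of `S₄` on `{1, 2, 3, 4} × {±1}`, through the signature on the second factor. -/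
def signedPerm : Perm (Fin 4) →* Perm (Fin 4 × ℤˣ) :=
  (prodPerm (Fin 4) ℤˣ).comp ((MonoidHom.id _).prod Perm.sign)

@[simp] theorem signedPerm_apply (g : Perm (Fin 4)) (x : Fin 4 × ℤˣ) :
    signedPerm g x = (g x.1, Perm.sign g * x.2) := rfl

/-- The double transpositions in `S₄`, and the identity. -/
def doubleTranspositions : Subgroup (Perm (Fin 4)) where
  carrier := {v | v * v = 1 ∧ (v = 1 ∨ ∀ i, v i ≠ i)}
  one_mem' := by simp
  mul_mem' {v w} := by
    revert v w
    set_option maxRecDepth 100000 in decide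
  inv_mem' {v} := by
    rintro ⟨h1, h2⟩
    rw [Set.mem_ofPred_eq, inv_eq_of_mul_eq_one_right h1]
    exact ⟨h1, h2⟩

theorem mem_doubleTranspositions {v : Perm (Fin 4)} :
    v ∈ doubleTranspositions ↔ v * v = 1 ∧ (v = 1 ∨ ∀ i, v i ≠ i) := Iff.rfl

instance : doubleTranspositions.Normal where
  conj_mem v hv g := by
    obtain ⟨h1, h2⟩ := mem_doubleTranspositions.1 hv
    refine mem_doubleTranspositions.2 ⟨?_, ?_⟩
    · rw [show g * v * g⁻¹ * (g * v * g⁻¹) = g * (v * v) * g⁻¹ by group, h1]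
      group
    · refine h2.imp (fun h => by rw [h]; group) fun h i hi => h (g⁻¹ i) ?_
      rw [Perm.eq_inv_iff_eq]
      exact hi

theorem isRegularSubgroup_doubleTranspositions : IsRegularSubgroup doubleTranspositions := by
  have key (i j : Fin 4) : ∃ v : Perm (Fin 4), (v * v = 1 ∧ (v = 1 ∨ ∀ i, v i ≠ i)) ∧ v i = j := by
    revert i j
    set_option maxRecDepth 100000 in decide
  intro i j
  obtain ⟨v, hv, hij⟩ := key i j
  refine ⟨v, ⟨hv, hij⟩, fun w ⟨hw, hwij⟩ => ?_⟩
  have h1 := mul_mem (inv_mem hv : v⁻¹ ∈ doubleTranspositions) hw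
  rcases (mem_doubleTranspositions.1 h1).2 with h | h
  · exact (inv_mul_eq_one.1 h).symm
  · exact (h i (by rw [Perm.mul_apply, hwij, ← hij]; exact v.symm_apply_apply i)).elim

/-- The group is `V₄ × {±1}`: a product of regular groups, and normal in `S₄ × {±1}`, through which
`signedPerm` factors. -/
theorem exists_isRegularSubgroup_signedPerm : ∃ N : Subgroup (Perm (Fin 4 × ℤˣ)),
    IsRegularSubgroup N ∧ signedPerm.range ≤ normalizer (N : Set _) := by
  refine ⟨(doubleTranspositions.prod ⊤).map (prodPerm (Fin 4) ℤˣ), fun ⟨i, u⟩ ⟨j, w⟩ => ?_, ?_⟩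
  · obtain ⟨v, ⟨hv, rfl⟩, huniq⟩ := isRegularSubgroup_doubleTranspositions i j
    refine ⟨_, ⟨⟨(v, w * u⁻¹), ⟨hv, mem_top _⟩, rfl⟩, by simp [mul_assoc]⟩, ?_⟩
    rintro _ ⟨⟨⟨v', s⟩, ⟨hv', -⟩, rfl⟩, h⟩
    obtain ⟨h1, h2⟩ := Prod.ext_iff.1 h
    obtain rfl := huniq v' ⟨hv', h1⟩
    obtain rfl : s * u = w := h2
    rw [mul_inv_cancel_right]
  · refine le_trans ?_ (le_normalizer_map _)
    rw [normalizer_eq_top, signedPerm, MonoidHom.range_comp]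
    exact Subgroup.map_mono le_top

theorem not_hasRegularNormal_signedPerm : ¬ HasRegularNormal signedPerm.range := by
  rintro ⟨N, hN, hnorm, hle⟩
  obtain ⟨n, ⟨hn, hn0⟩, huniq⟩ := hN (0, 1) (0, -1)
  obtain ⟨g, rfl⟩ := hle hn
  -- An odd `g` fixing 0 is a transposition of `{1,2,3}`, so it does not commute with a 3-cycle
  -- there. That 3-cycle is even and fixes 0, so the conjugate of `g` also takes `(0, 1)` to `(0,
  -- -1)`.
  have key : ∀ g : Perm (Fin 4), g 0 = 0 → Perm.sign g = -1 →
      (swap 1 2 * swap 2 3) * g * (swap 1 2 * swap 2 3)⁻¹ ≠ g := by decide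
  have h0 : g 0 = 0 := congrArg Prod.fst hn0
  have hs : Perm.sign g = -1 := by simpa using congrArg Prod.snd hn0
  refine key g h0 hs ?_
  have h1 := huniq (signedPerm ((swap 1 2 * swap 2 3) * g * (swap 1 2 * swap 2 3)⁻¹))
    ⟨by rw [map_mul, map_mul, map_inv]; exact mem_normalizer_of_le hnorm ⟨_, rfl⟩ hn, by
      have : ((swap 1 2 * swap 2 3)⁻¹ : Perm (Fin 4)) 0 = 0 := by decide
      have h3 : ((swap 1 2 * swap 2 3) : Perm (Fin 4)) 0 = 0 := by decide
      rw [signedPerm_apply, Perm.mul_apply, Perm.mul_apply, this, h0, h3, map_mul, map_mul, map_inv,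
        mul_inv_cancel_comm, hs]
      rfl⟩
  refine Equiv.ext fun i => ?_
  exact congrArg Prod.fst (Equiv.congr_fun h1 (i, 1))

theorem exists_signedPerm_apply_eq (x y : Fin 4 × ℤˣ) : ∃ g, signedPerm g x = y := by
  obtain ⟨i, u⟩ := x
  obtain ⟨j, w⟩ := y
  have key : ∀ (i j : Fin 4) (s : ℤˣ), ∃ g : Perm (Fin 4), (g i, Perm.sign g) = (j, s) := by
    set_option maxRecDepth 100000 in decide
  obtain ⟨g, hg⟩ := key i j (w * u⁻¹)
  obtain ⟨h1, h2⟩ := Prod.ext_iff.1 hg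
  exact ⟨g, Prod.ext h1 ((congrArg (· * u) h2).trans (inv_mul_cancel_right w u))⟩

end PermFour

/-! ### Quartic polynomials, their roots and their discriminants -/

section Quartic

open Equiv

variable {k : Type u} {E : Type v} [Field k] [Field E] [Algebra k E] {f : k[X]}

/-- A labelling of the roots of a separable quartic polynomial, with the corresponding permutation
representation of the Galois group. -/
theorem exists_root_labelling (hsep : f.Separable) (hdeg : f.natDegree = 4)
    [hs : Fact ((f.map (algebraMap k E)).Splits)] :
    ∃ (r : Fin 4 → E) (ρ : f.Gal →* Perm (Fin 4)), Function.Injective r ∧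
      (f.map (algebraMap k E)).roots = Finset.univ.val.map r ∧ Function.Injective ρ ∧
      ∀ (γ : Gal(E/k)) (i : Fin 4), γ (r i) = r (ρ (Gal.restrict f E γ) i) := by
  classical
  have hcard : Fintype.card (f.rootSet E) = 4 := by
    rw [card_rootSet_eq_natDegree hsep hs.out, hdeg]
  let e : Fin 4 ≃ f.rootSet E := (Fintype.equivFinOfCardEq hcard).symm
  refine ⟨fun i => e i, e.symm.permCongrHom.toMonoidHom.comp (Gal.galActionHom f E),
    Subtype.val_injective.comp e.injective, ?_,
    e.symm.permCongrHom.injective.comp (Gal.galActionHom_injective f E), fun γ i => ?_⟩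
  · refine (Multiset.Nodup.ext (nodup_roots hsep.map)
      ((Multiset.nodup_map_iff_of_injective (Subtype.val_injective.comp e.injective)).2
        Finset.univ.nodup)).2 fun a => ?_
    have h1 : a ∈ f.rootSet E ↔ a ∈ (f.map (algebraMap k E)).roots := by
      rw [rootSet, Finset.mem_coe, Multiset.mem_toFinset]
    rw [← h1]
    refine ⟨fun h => Multiset.mem_map.2 ⟨e.symm ⟨a, h⟩, Finset.mem_univ (α := Fin 4) _, by simp⟩,
      fun h => ?_⟩
    obtain ⟨i, -, rfl⟩ := Multiset.mem_map.1 h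
    exact (e i).2
  · have := Gal.galActionHom_restrict f E γ (e i)
    simpa using this.symm

theorem prod_Ioi_fin_four {R : Type*} [CommRing R] (r : Fin 4 → R) :
    ∏ i, ∏ j ∈ Finset.Ioi i, (r j - r i) = (r 1 - r 0) * (r 2 - r 0) * (r 3 - r 0) *
      ((r 2 - r 1) * (r 3 - r 1)) * (r 3 - r 2) := by
  have h0 : Finset.Ioi (0 : Fin 4) = {1, 2, 3} := by decide
  have h1 : Finset.Ioi (1 : Fin 4) = {2, 3} := by decide
  have h2 : Finset.Ioi (2 : Fin 4) = {3} := by decide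
  have h3 : Finset.Ioi (3 : Fin 4) = ∅ := by decide
  simp [Fin.prod_univ_four, h0, h1, h2, h3]
  ring

theorem prod_eval_derivative_of_roots {g : E[X]} (hg : g.Splits) {r : Fin 4 → E}
    (hr : g.roots = Finset.univ.val.map r) : (g.roots.map g.derivative.eval).prod =
      g.leadingCoeff ^ 4 * (∏ i, ∏ j ∈ Finset.Ioi i, (r j - r i)) ^ 2 := by
  have h1 : g = C g.leadingCoeff *
      ((X - C (r 0)) * (X - C (r 1)) * (X - C (r 2)) * (X - C (r 3))) := by
    conv_lhs => rw [hg.eq_prod_roots, hr]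
    rw [Multiset.map_map]
    change _ * (∏ i, (X - C (r i))) = _
    rw [Fin.prod_univ_four]
  rw [prod_Ioi_fin_four, hr, Multiset.map_map]
  change ∏ i, g.derivative.eval (r i) = _
  generalize g.leadingCoeff = a at *
  subst h1
  simp [Fin.prod_univ_four, derivative_mul]
  ring

/-- The resultant of `f` and `f'` is `a⁷ ∏ (rⱼ - rᵢ)²`, with `a` the leading coefficient, and also
`a · disc f`, the sign being `(-1)⁶`. -/
theorem algebraMap_discr_of_roots (hdeg : f.natDegree = 4)
    (hs : (f.map (algebraMap k E)).Splits) {r : Fin 4 → E}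
    (hr : (f.map (algebraMap k E)).roots = Finset.univ.val.map r) :
    algebraMap k E f.discr =
      (algebraMap k E f.leadingCoeff ^ 3 * ∏ i, ∏ j ∈ Finset.Ioi i, (r j - r i)) ^ 2 := by
  have h0 : 0 < f.degree := natDegree_pos_iff_degree_pos.1 (by omega)
  have hlc : algebraMap k E f.leadingCoeff ≠ 0 := by
    rw [Ne, map_eq_zero, leadingCoeff_eq_zero]
    rintro rfl
    simp at hdeg
  have h1 := congrArg (algebraMap k E) (resultant_deriv h0)
  rw [← resultant_map_map, ← natDegree_map (algebraMap k E),
    resultant_eq_prod_eval _ _ _ (by rw [← derivative_map]; exact natDegree_derivative_le _) hs,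
    ← derivative_map, prod_eval_derivative_of_roots hs hr, leadingCoeff_map, natDegree_map, hdeg] at h1
  apply mul_left_cancel₀ hlc
  simp only [map_mul, map_pow, map_neg, map_one] at h1
  norm_num at h1
  rw [← h1]
  ring

/-- The product is a Vandermonde determinant, and `g` permutes its rows. -/
theorem prod_Ioi_perm {R : Type*} [CommRing R] (r : Fin 4 → R) (g : Perm (Fin 4)) :
    ∏ i, ∏ j ∈ Finset.Ioi i, (r (g j) - r (g i)) =
      ((Perm.sign g : ℤ) : R) * ∏ i, ∏ j ∈ Finset.Ioi i, (r j - r i) := by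
  rw [← Matrix.det_vandermonde, ← Matrix.det_vandermonde r, ← Matrix.det_permute]
  rfl

end Quartic

/-! ### The extension generated by a root and a square root of the discriminant -/

section RootSqrtDiscr

open Equiv

variable {k : Type u} [Field k] {f : k[X]}

theorem splits_of_algHom_normal {K E : Type*} [Field K] [Field E] [Algebra k K] [Algebra k E]
    [Normal k E] (σ : K →ₐ[k] E) (hf : Irreducible f) {a : K} (ha : aeval a f = 0) :
    (f.map (algebraMap k E)).Splits := by
  have h1 : aeval (σ a) f = 0 := by rw [aeval_algHom_apply, ha, map_zero]
  have hint : IsIntegral k (σ a) := Normal.isIntegral inferInstance _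
  have h2 : f ∣ minpoly k (σ a) := (minpoly.irreducible hint).dvd_symm hf (minpoly.dvd _ _ h1)
  exact (Normal.splits inferInstance (σ a)).of_dvd
    (Polynomial.map_ne_zero (minpoly.ne_zero hint)) (Polynomial.map_dvd _ h2)

variable [CharZero k]

/-- An embedding sends `a` to a root `rᵢ` and `e` to `±D`, where `D² = disc f` and `γ` multiplies
`D` by its signature. All eight pairs occur because `signedPerm` is transitive and every permutation
of the roots is realized; the degree 8 is then a consequence. -/
theorem exists_equiv_embedding {K E : Type v} [Field K] [Field E] [Algebra k K] [Algebra k E]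
    [Normal k E] (σ₀ : K →ₐ[k] E) (hf : Irreducible f) (hdeg : f.natDegree = 4)
    (hG : Nonempty (f.Gal ≃* Perm (Fin 4))) {a e : K} (ha : aeval a f = 0)
    (he : e ^ 2 = algebraMap k K f.discr)
    (hK : ∀ σ τ : K →ₐ[k] E, σ a = τ a → σ e = τ e → σ = τ) :
    ∃ Ψ : (K →ₐ[k] E) ≃ Fin 4 × ℤˣ,
      (embeddingAction k K E).range.map Ψ.permCongrHom.toMonoidHom = signedPerm.range := by
  have : CharZero E := charZero_of_injective_algebraMap (algebraMap k E).injective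
  have : Fact ((f.map (algebraMap k E)).Splits) := ⟨splits_of_algHom_normal σ₀ hf ha⟩
  obtain ⟨r, ρ', hr, hroots, hρ', hrρ⟩ := exists_root_labelling (E := E) hf.separable hdeg
  obtain ⟨φ⟩ := hG
  have hρ's : Function.Surjective ρ' :=
    ((Nat.bijective_iff_injective_and_card ρ').2 ⟨hρ', Nat.card_congr φ.toEquiv⟩).2
  let ρ : Gal(E/k) →* Perm (Fin 4) := ρ'.comp (Gal.restrict f E)
  have hρ : Function.Surjective ρ := hρ's.comp (Gal.restrict_surjective f E)
  have hrρ (γ : Gal(E/k)) (i : Fin 4) : γ (r i) = r (ρ γ i) := hrρ γ i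
  let D : E := algebraMap k E f.leadingCoeff ^ 3 * ∏ i, ∏ j ∈ Finset.Ioi i, (r j - r i)
  have hD : algebraMap k E f.discr = D ^ 2 := algebraMap_discr_of_roots hdeg Fact.out hroots
  have hD0 : D ≠ 0 := by
    refine mul_ne_zero (pow_ne_zero _ ?_) (Finset.prod_ne_zero_iff.2 fun i _ =>
      Finset.prod_ne_zero_iff.2 fun j hj => sub_ne_zero.2 (hr.ne (Finset.mem_Ioi.1 hj).ne'))
    rw [Ne, map_eq_zero, leadingCoeff_eq_zero]
    exact hf.ne_zero
  have hγD (γ : Gal(E/k)) : γ D = ((Perm.sign (ρ γ) : ℤ) : E) * D := by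
    simp only [D, map_mul, map_pow, map_prod, map_sub, AlgEquiv.commutes, hrρ]
    rw [prod_Ioi_perm]
    ring
  have hu {u w : ℤˣ} (h : ((u : ℤ) : E) * D = ((w : ℤ) : E) * D) : u = w :=
    Units.ext (Int.cast_injective (mul_right_cancel₀ hD0 h))
  have key (σ : K →ₐ[k] E) : ∃ x : Fin 4 × ℤˣ, σ a = r x.1 ∧ σ e = ((x.2 : ℤ) : E) * D := by
    have h1 : σ a ∈ (f.map (algebraMap k E)).roots := by
      rw [mem_roots (Polynomial.map_ne_zero hf.ne_zero), IsRoot.def, eval_map_algebraMap,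
        aeval_algHom_apply, ha, map_zero]
    rw [hroots] at h1
    obtain ⟨i, -, hi⟩ := Multiset.mem_map.1 h1
    have h2 : σ e ^ 2 = D ^ 2 := by rw [← map_pow, he, AlgHom.commutes, hD]
    rcases sq_eq_sq_iff_eq_or_eq_neg.1 h2 with h2 | h2
    · exact ⟨(i, 1), hi.symm, by simp [h2]⟩
    · exact ⟨(i, -1), hi.symm, by simp [h2]⟩
  choose Ψ hΨa hΨe using key
  have heq (γ : Gal(E/k)) (σ : K →ₐ[k] E) :
      Ψ (embeddingAction k K E γ σ) = signedPerm (ρ γ) (Ψ σ) := by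
    refine Prod.ext (hr ?_) (hu ?_)
    · rw [← hΨa, embeddingAction_apply, hΨa, hrρ, signedPerm_apply]
    · rw [← hΨe, embeddingAction_apply, hΨe, map_mul, hγD, map_intCast, signedPerm_apply]
      push_cast
      ring
  have hbij : Function.Bijective Ψ := by
    refine ⟨fun σ τ h => ?_, fun x => ?_⟩
    · exact hK σ τ (by rw [hΨa, hΨa, h]) (by rw [hΨe, hΨe, h])
    · obtain ⟨g, hg⟩ := exists_signedPerm_apply_eq (Ψ σ₀) x
      obtain ⟨γ, rfl⟩ := hρ g
      exact ⟨_, (heq γ σ₀).trans hg⟩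
  refine ⟨Equiv.ofBijective Ψ hbij, ?_⟩
  have h1 (γ : Gal(E/k)) : (Equiv.ofBijective Ψ hbij).permCongr (embeddingAction k K E γ) =
      signedPerm (ρ γ) := by
    refine Equiv.ext fun x => ?_
    obtain ⟨σ, rfl⟩ := hbij.2 x
    rw [permCongr_apply, ← heq]
    exact congrArg (fun τ => Ψ (embeddingAction k K E γ τ))
      ((Equiv.ofBijective Ψ hbij).symm_apply_apply σ)
  ext g
  constructor
  · rintro ⟨_, ⟨γ, rfl⟩, rfl⟩
    exact ⟨ρ γ, (h1 γ).symm⟩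
  · rintro ⟨g, rfl⟩
    obtain ⟨γ, rfl⟩ := hρ g
    exact ⟨_, ⟨γ, rfl⟩, h1 γ⟩

theorem isHopfGalois_and_not_isAlmostClassicallyGalois {K : Type v} [Field K] [Algebra k K]
    [FiniteDimensional k K] (hf : Irreducible f) (hdeg : f.natDegree = 4)
    (hG : Nonempty (f.Gal ≃* Perm (Fin 4))) {a e : K} (ha : aeval a f = 0)
    (he : e ^ 2 = algebraMap k K f.discr)
    (hK : ∀ σ τ : K →ₐ[k] GaloisClosure k K, σ a = τ a → σ e = τ e → σ = τ) :
    Module.finrank k K = 8 ∧ IsHopfGalois k K ∧ ¬ IsAlmostClassicallyGalois k K := by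
  classical
  let σ₀ : K →ₐ[k] GaloisClosure k K := IsScalarTower.toAlgHom k K (GaloisClosure k K)
  obtain ⟨Ψ, hΨ⟩ := exists_equiv_embedding σ₀ hf hdeg hG ha he hK
  have hback (N : Subgroup (Perm (Fin 4 × ℤˣ))) (M : Subgroup (Perm (K →ₐ[k] GaloisClosure k K)))
      (h : M.map Ψ.permCongrHom.toMonoidHom = N) : N.map Ψ.symm.permCongrHom.toMonoidHom = M := by
    subst h
    rw [Subgroup.map_map]
    convert M.map_id
    ext
    simp
  refine ⟨?_, ?_, fun h => not_hasRegularNormal_signedPerm ?_⟩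
  · rw [← card_embedding, Nat.card_congr Ψ, Nat.card_eq_fintype_card]
    decide
  · obtain ⟨N, hN, hnorm⟩ := exists_isRegularSubgroup_signedPerm
    have : Finite (K →ₐ[k] GaloisClosure k K) := .of_equiv _ Ψ.symm
    have : Fintype (N.map Ψ.symm.permCongrHom.toMonoidHom) := Fintype.ofFinite _
    refine isHopfGalois_of_isRegularSubgroup σ₀ (isRegularSubgroup_map_permCongr Ψ.symm hN) ?_
    rw [← hback _ _ hΨ]
    exact (Subgroup.map_mono hnorm).trans (Subgroup.le_normalizer_map _)
  · rw [← hΨ]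
    exact (isAlmostClassicallyGalois_iff.1 h).map_permCongr Ψ

end RootSqrtDiscr

/-! ### A quartic with symmetric Galois group -/

section Example

open Equiv

/-- A rational root would be an integer `n` with `n (n² + 4) = 1`. This cubic is the resolvent of
`X⁴ - X - 1`. -/
theorem irreducible_X_pow_three_add : Irreducible (X ^ 3 + C 4 * X - 1 : ℚ[X]) := by
  have hdeg : (X ^ 3 + C 4 * X - 1 : ℚ[X]).natDegree = 3 := by
    rw [show (X ^ 3 + C 4 * X - 1 : ℚ[X]) = X ^ 3 + C 4 * X - C 1 by simp]
    compute_degree!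
  refine (irreducible_iff_roots_eq_zero_of_degree_le_three (by omega) (by omega)).2
    (Multiset.eq_zero_of_forall_notMem fun q hq => ?_)
  have hq0 : q ^ 3 + 4 * q - 1 = 0 := by simpa using isRoot_of_mem_roots hq
  have hint : IsIntegral ℤ q := by
    refine ⟨X ^ 3 + C 4 * X - 1, ?_, by simpa using hq0⟩
    rw [show (X ^ 3 + C 4 * X - 1 : ℤ[X]) = X ^ 3 + C 4 * X - C 1 by simp]
    monicity!
  obtain ⟨n, rfl⟩ := IsIntegrallyClosed.isIntegral_iff.1 hint
  have h1 : n * (n ^ 2 + 4) = 1 := by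
    have : ((n * (n ^ 2 + 4) : ℤ) : ℚ) = 1 := by
      push_cast
      rw [eq_intCast] at hq0
      linear_combination hq0
    exact_mod_cast this
  rcases Int.eq_one_or_neg_one_of_mul_eq_one h1 with rfl | rfl <;> norm_num at h1

theorem natDegree_X_pow_four_sub {R : Type*} [CommRing R] [Nontrivial R] :
    (X ^ 4 - X - 1 : R[X]).natDegree = 4 := by
  rw [← C_1]
  compute_degree!

theorem irreducible_X_pow_four_sub : Irreducible (X ^ 4 - X - 1 : ℚ[X]) :=
  X_pow_sub_X_sub_one_irreducible_rat (by norm_num)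

theorem natDegree_dvd_finrank {F E : Type*} [Field F] [Field E] [Algebra F E]
    [FiniteDimensional F E]
    {p : F[X]} (hp : Irreducible p) {x : E} (hx : aeval x p = 0) :
    p.natDegree ∣ Module.finrank F E := by
  have hint : IsIntegral F x := .of_finite F x
  have h1 : p.natDegree = (minpoly F x).natDegree := natDegree_eq_of_degree_eq
    (degree_eq_degree_of_associated
      ((minpoly.irreducible hint).associated_of_dvd hp (minpoly.dvd F x hx)).symm)
  rw [h1, ← IntermediateField.adjoin.finrank hint]
  exact ⟨_, (Module.finrank_mul_finrank F F⟮x⟯ E).symm⟩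

variable {E : Type*} [Field E] [CharZero E]

theorem vieta_X_pow_four_sub {r : Fin 4 → E}
    (h : (X ^ 4 - X - 1 : E[X]) = (X - C (r 0)) * (X - C (r 1)) * (X - C (r 2)) * (X - C (r 3))) :
    r 0 + r 1 + r 2 + r 3 = 0 ∧
    r 0 * r 1 + r 0 * r 2 + r 0 * r 3 + r 1 * r 2 + r 1 * r 3 + r 2 * r 3 = 0 ∧
    r 0 * r 1 * r 2 + r 0 * r 1 * r 3 + r 0 * r 2 * r 3 + r 1 * r 2 * r 3 = 1 ∧
    r 0 * r 1 * r 2 * r 3 = -1 := by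
  -- The values at `0`, `1`, `-1`, `2` determine the four elementary symmetric functions.
  have H (c : E) := congrArg (eval c) h
  simp only [eval_sub, eval_mul, eval_pow, eval_X, eval_one, eval_C] at H
  have h0 := H 0
  have h1 := H 1
  have hm := H (-1)
  have h2 := H 2
  have e2 : r 0 * r 1 + r 0 * r 2 + r 0 * r 3 + r 1 * r 2 + r 1 * r 3 + r 2 * r 3 = 0 := by
    linear_combination -(h1 + hm) / 2 + h0
  have e1 : r 0 + r 1 + r 2 + r 3 = 0 := by
    linear_combination (h2 - (h1 - hm) + 4 * e2 - h0) / 6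
  exact ⟨e1, e2, by linear_combination (h1 - hm) / 2 - e1, by linear_combination -h0⟩

/-- The square is `∏ f'(rᵢ)`. Since `r f'(r) = 4 r⁴ - r = 3 r + 4` at a root, and `∏ (3 rᵢ + 4) =
256 + 108 - 81 = 283`, dividing by `∏ rᵢ = -1` gives the value. -/
theorem sq_prod_roots_X_pow_four_sub {r : Fin 4 → E}
    (h : (X ^ 4 - X - 1 : E[X]) = (X - C (r 0)) * (X - C (r 1)) * (X - C (r 2)) * (X - C (r 3))) :
    (∏ i, ∏ j ∈ Finset.Ioi i, (r j - r i)) ^ 2 = -283 := by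
  obtain ⟨e1, e2, e3, e4⟩ := vieta_X_pow_four_sub h
  have hroot (i : Fin 4) : r i ^ 4 = r i + 1 := by
    have := congrArg (eval (r i)) h
    simp only [eval_sub, eval_mul, eval_pow, eval_X, eval_one, eval_C] at this
    have h2 : (r i - r 0) * (r i - r 1) * (r i - r 2) * (r i - r 3) = 0 := by
      fin_cases i <;> simp
    linear_combination this + h2
  have hder (i : Fin 4) : eval (r i) (derivative (X ^ 4 - X - 1 : E[X])) = 4 * r i ^ 3 - 1 := by
    simp [derivative_pow]
  have h1 : (∏ i, ∏ j ∈ Finset.Ioi i, (r j - r i)) ^ 2 = ∏ i, (4 * r i ^ 3 - 1) := by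
    simp_rw [← hder, h]
    rw [prod_Ioi_fin_four, Fin.prod_univ_four]
    simp [derivative_mul]
    ring
  have h2 : ∏ i, (r i * (4 * r i ^ 3 - 1)) = 283 := by
    have (i : Fin 4) : r i * (4 * r i ^ 3 - 1) = 3 * r i + 4 := by linear_combination 4 * hroot i
    simp_rw [this, Fin.prod_univ_four]
    linear_combination 192 * e1 + 144 * e2 + 108 * e3 + 81 * e4
  rw [Finset.prod_mul_distrib, ← h1, Fin.prod_univ_four, e4] at h2
  linear_combination -h2

theorem resolvent_root_X_pow_four_sub {r : Fin 4 → E}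
    (h : (X ^ 4 - X - 1 : E[X]) = (X - C (r 0)) * (X - C (r 1)) * (X - C (r 2)) * (X - C (r 3))) :
    (r 0 * r 1 + r 2 * r 3) ^ 3 + 4 * (r 0 * r 1 + r 2 * r 3) - 1 = 0 := by
  obtain ⟨h1, h2, h3, h4⟩ := vieta_X_pow_four_sub h
  have key (e1 e2 e3 e4 : E) (h1 : r 0 + r 1 + r 2 + r 3 = e1)
      (h2 : r 0 * r 1 + r 0 * r 2 + r 0 * r 3 + r 1 * r 2 + r 1 * r 3 + r 2 * r 3 = e2)
      (h3 : r 0 * r 1 * r 2 + r 0 * r 1 * r 3 + r 0 * r 2 * r 3 + r 1 * r 2 * r 3 = e3)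
      (h4 : r 0 * r 1 * r 2 * r 3 = e4) :
      (r 0 * r 1 + r 2 * r 3) ^ 3 - e2 * (r 0 * r 1 + r 2 * r 3) ^ 2 +
        (e1 * e3 - 4 * e4) * (r 0 * r 1 + r 2 * r 3) -
        (e3 ^ 2 + e1 ^ 2 * e4 - 4 * e2 * e4) = 0 := by
    subst h1 h2 h3 h4
    ring
  linear_combination key 0 0 1 (-1) h1 h2 h3 h4

/-- The quartic and its irreducible resolvent cubic make the order divisible by 12, so the group is
`A₄` or `S₄`. In `A₄` the product of root differences would be rational, with square `-283`. -/
theorem nonempty_gal_X_pow_four_sub_equiv :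
    Nonempty ((X ^ 4 - X - 1 : ℚ[X]).Gal ≃* Perm (Fin 4)) := by
  set f : ℚ[X] := X ^ 4 - X - 1 with hf
  have hirr : Irreducible f := irreducible_X_pow_four_sub
  have hdeg : f.natDegree = 4 := natDegree_X_pow_four_sub
  obtain ⟨E, _, _, hE⟩ : ∃ (E : Type) (_ : Field E) (_ : Algebra ℚ E), IsSplittingField ℚ E f :=
    ⟨f.SplittingField, _, _, IsSplittingField.splittingField f⟩
  have : CharZero E := charZero_of_injective_algebraMap (algebraMap ℚ E).injective
  have : FiniteDimensional ℚ E := IsSplittingField.finiteDimensional E f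
  have : Fact ((f.map (algebraMap ℚ E)).Splits) := ⟨hE.splits⟩
  obtain ⟨r, ρ, hr, hroots, hρ, hrρ⟩ := exists_root_labelling (E := E) hirr.separable hdeg
  have hprod : (X ^ 4 - X - 1 : E[X]) =
      (X - C (r 0)) * (X - C (r 1)) * (X - C (r 2)) * (X - C (r 3)) := by
    have h1 : f.map (algebraMap ℚ E) = X ^ 4 - X - 1 := by simp [f]
    have h2 : (f.map (algebraMap ℚ E)).Monic := by
      rw [h1, ← C_1]
      monicity!
    rw [← h1, hE.splits.eq_prod_roots_of_monic h2, hroots, Multiset.map_map]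
    exact Fin.prod_univ_four fun i => X - C (r i)
  have hcard : Nat.card ρ.range = Module.finrank ℚ E := by
    rw [(IsSplittingField.algEquiv E f).toLinearEquiv.finrank_eq,
      ← Gal.card_of_separable hirr.separable]
    exact (Nat.card_congr (MonoidHom.ofInjective hρ).toEquiv).symm
  have h4 : 4 ∣ Nat.card ρ.range := by
    rw [hcard, ← hdeg]
    refine natDegree_dvd_finrank hirr (x := r 0) ?_
    have : r 0 ∈ (f.map (algebraMap ℚ E)).roots := by
      rw [hroots]; exact Multiset.mem_map.2 ⟨0, Finset.mem_univ (α := Fin 4) _, rfl⟩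
    rw [← eval_map_algebraMap]
    exact isRoot_of_mem_roots this
  have h3 : 3 ∣ Nat.card ρ.range := by
    have h := natDegree_dvd_finrank (E := E) irreducible_X_pow_three_add
      (x := r 0 * r 1 + r 2 * r 3) (by
        simpa using resolvent_root_X_pow_four_sub hprod)
    rw [hcard]
    convert h
    rw [show (X ^ 3 + C 4 * X - 1 : ℚ[X]) = X ^ 3 + C 4 * X - C 1 by simp]
    symm
    compute_degree!
  have h12 : 12 ∣ Nat.card ρ.range := Nat.Coprime.mul_dvd_of_dvd_of_dvd (by norm_num) h3 h4
  have h24 : Nat.card ρ.range * ρ.range.index = 24 := by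
    rw [Subgroup.card_mul_index, Nat.card_eq_fintype_card, Fintype.card_perm]
    rfl
  obtain ⟨m, hm⟩ := h12
  have hodd : ρ.range ≠ alternatingGroup (Fin 4) := by
    intro h
    let D : E := ∏ i, ∏ j ∈ Finset.Ioi i, (r j - r i)
    have hD : D ^ 2 = -283 := sq_prod_roots_X_pow_four_sub hprod
    have hfix (γ : Gal(E/ℚ)) : γ D = D := by
      have h1 : Perm.sign (ρ (Gal.restrict f E γ)) = 1 :=
        Perm.mem_alternatingGroup.1 (h ▸ ⟨_, rfl⟩)
      simp only [D, map_prod, map_sub, hrρ]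
      rw [prod_Ioi_perm, h1]
      simp
    have : IsGalois ℚ E := IsGalois.of_separable_splitting_field hirr.separable
    obtain ⟨q, hq⟩ := (IsGalois.mem_range_algebraMap_iff_fixed D).2 hfix
    have h2 : q ^ 2 = -283 := by
      apply (algebraMap ℚ E).injective
      rw [map_pow, hq, hD]
      simp
    nlinarith [sq_nonneg q]
  have htop : ρ.range = ⊤ := by
    rw [← Subgroup.index_eq_one]
    have h5 : m * ρ.range.index = 2 := by
      rw [hm, mul_assoc] at h24
      omega
    rcases (Nat.dvd_prime Nat.prime_two).1 ⟨m, by rw [mul_comm, h5]⟩ with h6 | h6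
    · exact h6
    · exact (hodd (Perm.eq_alternatingGroup_of_index_eq_two h6)).elim
  exact ⟨MulEquiv.ofBijective ρ ⟨hρ, MonoidHom.range_eq_top.1 htop⟩⟩

end Example

/-! ### The extension generated inside an arbitrary field, and the theorem -/

theorem finrank_eq_eight_and_isHopfGalois_adjoin {k : Type v} [Field k] [CharZero k] {f : k[X]}
    (hf : Irreducible f) (hdeg : f.natDegree = 4) (hG : Nonempty (f.Gal ≃* Equiv.Perm (Fin 4)))
    {L : Type u} [Field L] [Algebra k L] {x δ : L} (hx : aeval x f = 0)
    (hδ : δ ^ 2 = algebraMap k L f.discr) :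
    Module.finrank k k⟮x, δ⟯ = 8 ∧ IsHopfGalois k k⟮x, δ⟯ ∧
      ¬ IsAlmostClassicallyGalois k k⟮x, δ⟯ := by
  have hxm : x ∈ k⟮x, δ⟯ := IntermediateField.subset_adjoin _ _ (by simp)
  have hδm : δ ∈ k⟮x, δ⟯ := IntermediateField.subset_adjoin _ _ (by simp)
  have hxi : IsIntegral k x := (isAlgebraic_iff_isIntegral).1 ⟨f, hf.ne_zero, hx⟩
  have hδi : IsIntegral k δ := .of_pow two_pos (hδ ▸ isIntegral_algebraMap)
  have : FiniteDimensional k k⟮x, δ⟯ := IntermediateField.finiteDimensional_adjoin (by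
    rintro y (rfl | rfl)
    exacts [hxi, hδi])
  have hx' : aeval (⟨x, hxm⟩ : k⟮x, δ⟯) f = 0 := by
    refine k⟮x, δ⟯.val.toRingHom.injective ?_
    change k⟮x, δ⟯.val _ = k⟮x, δ⟯.val 0
    rw [← aeval_algHom_apply, map_zero]
    exact hx
  refine isHopfGalois_and_not_isAlmostClassicallyGalois hf hdeg hG (a := ⟨x, hxm⟩) (e := ⟨δ, hδm⟩)
    hx' (Subtype.ext hδ) fun σ τ h1 h2 => IntermediateField.adjoin_algHom_ext k ?_
  rintro y (rfl | rfl)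
  exacts [h1, h2]

theorem mainTheorem3 :
    -- the extension `ℚ(x, √d)/ℚ`
    (∀ (f : ℚ[X]), Irreducible f → f.natDegree = 4 → Nonempty (f.Gal ≃* Equiv.Perm (Fin 4)) →
      ∀ (L : Type u) [Field L] [Algebra ℚ L] (x δ : L),
        aeval x f = 0 → δ ^ 2 = algebraMap ℚ L f.discr →
          Module.finrank ℚ ℚ⟮x, δ⟯ = 8 ∧
          IsHopfGalois ℚ ℚ⟮x, δ⟯ ∧
          ¬ IsAlmostClassicallyGalois ℚ ℚ⟮x, δ⟯) ∧
    -- degree 8 occurs, already over `ℚ`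
    (∃ (K : Type) (_ : Field K) (_ : Algebra ℚ K),
      Module.finrank ℚ K = 8 ∧ IsHopfGalois ℚ K ∧ ¬ IsAlmostClassicallyGalois ℚ K) ∧
    -- and no smaller degree does, over any field
    (∀ (k : Type v) (K : Type w) [Field k] [Field K] [Algebra k K]
      [FiniteDimensional k K] [Algebra.IsSeparable k K],
        Module.finrank k K < 8 → IsHopfGalois k K → IsAlmostClassicallyGalois k K) := by
  -- A field has at most one `ℚ`-algebra structure, so the result does not depend on which instance
  -- `ℚ⟮x, δ⟯` carries.
  have hrat {K : Type u} [Field K] (A : Algebra ℚ K)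
      (h : @IsHopfGalois ℚ K _ _ A ∧ ¬ @IsAlmostClassicallyGalois ℚ K _ _ A) (B : Algebra ℚ K) :
      @IsHopfGalois ℚ K _ _ B ∧ ¬ @IsAlmostClassicallyGalois ℚ K _ _ B := Subsingleton.elim A B ▸ h
  refine ⟨fun f hf hdeg hG L _ _ x δ hx hδ => ?_, ?_,
    fun k K _ _ _ _ _ hn h => isAlmostClassicallyGalois_of_finrank_lt_eight hn h⟩
  · have h := finrank_eq_eight_and_isHopfGalois_adjoin hf hdeg hG hx hδ
    exact ⟨h.1, hrat _ h.2 _⟩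
  · obtain ⟨x, hx⟩ := IsAlgClosed.exists_aeval_eq_zero (AlgebraicClosure ℚ) (X ^ 4 - X - 1 : ℚ[X])
      irreducible_X_pow_four_sub.degree_pos.ne'
    obtain ⟨δ, hδ⟩ := IsAlgClosed.exists_pow_nat_eq
      (algebraMap ℚ (AlgebraicClosure ℚ) (X ^ 4 - X - 1 : ℚ[X]).discr) two_pos
    exact ⟨ℚ⟮x, δ⟯, _, _, finrank_eq_eight_and_isHopfGalois_adjoin
      irreducible_X_pow_four_sub natDegree_X_pow_four_sub nonempty_gal_X_pow_four_sub_equiv hx hδ⟩
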